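/- Let $X$ be a set of variables, $\Sigma$ a finite nonempty alphabet, and let $\alpha = y_1 y_2 \cdots y_n$ ($n\ge 1$, $y_i\in X$) be a terminal-free pattern. Its pattern language is $L(\alpha)=\{\sigma(\alpha) \mid \sigma : X^*\to\Sigma^* \text{ a morphism}\}$ (variables may be mapped to the empty word). **Janus operating modes.** For a variable $x$ with $n_x\ge 1$ occurrences in $\alpha$, a *matching order for $x$* is a sequence of $n_x-1$ pairs $(l,r)$ of positions of $x$ in $\alpha$, $l<r$, such that the graph on the positions of $x$ with these pairs as edges is connected. A *complete matching order for $\alpha$* is a sequence $((l_1,r_1),\dots,(l_k,r_k))$ with $k=\sum_x (n_x-1)$ that contains all the pairs of some family of matching orders, one for each variable of $\alpha$. Put $l_0=r_0=0$, let $g(j,j')=(j+1,\dots,j'-1)$ if $j<j'$ and $g(j,j')=(j,j-1,\dots,j')$ if $j'\le j$, and let $\lambda,\rho$ be two markers. A *Janus operating mode for $\alpha$* derived from this order is a tuple $\Delta=(D_1,\dots,D_k)$, where each $D_i$ is a sequence $D_i'$ followed by $(r_i,\rho),(l_i,\lambda)$, and $D_i'$ is a shuffle (keeping relative orders) of the sequence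 $g(l_{i-1},l_i)$, marked $\lambda$, and the sequence $g(r_{i-1},r_i)$, marked $\rho$, such that, if both sequences are nonempty, then for every entry of $D_i'$ the current $\lambda$-number is at most the current $\rho$-number. Here the current number of a marker at an entry is the last number with this marker up to and including that entry, or the first number with this marker in $D_i'$ if there is none yet. Let $((d_1,\mu_1),\dots,(d_{k'},\mu_{k'}))$ be the concatenation of $D_1,\dots,D_k$. The *counter number* $\mathrm{cn}(\Delta)$ is the maximum over $1\le i\le k'$ of the number of variables $x\ne y_{d_i}$ with $y_{d_j}=y_{d_{j'}}=x$ for some $j<i<j'$ (and $0$ if $k'=0$). **Janus automata.** A *Janus automaton with $\pi$ counters* over $\Sigma$ consists of a finite set $Q$ of states, an initial state $q_0\in Q$, a set $F\subseteq Q$ of accepting states, and a transition function $$\delta : Q\times(\Sigma\cup\{\text{¢},\$\})^2\times\{\mathtt{t_=},\mathtt{t_<}\}^\pi\to Q\times\{-1,0,1\}^2\times\{0,1,\mathtt r\}^\pi ,$$ where ¢ and $\$$ are endmarkers not in $\Sigma$. For an input $w=b_1\cdots b_m\in\Sigma^*$ put $b_0=\text{¢}$ and $b_{m+1}=\$$.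 A configuration is $(q,h_1,h_2,(c_1,C_1),\dots,(c_\pi,C_\pi))$ with $q\in Q$, $0\le h_1\le h_2\le m+1$ and $0\le c_j\le C_j\le m$. In one move, $\delta$ is applied to $q,b_{h_1},b_{h_2}$ and the messages $s_j=\mathtt{t_=}$ if $c_j=C_j$, $s_j=\mathtt{t_<}$ if $c_j<C_j$; let $(q',r_1,r_2,d_1,\dots,d_\pi)$ be the result. The new state is $q'$. Each $h_i$ becomes $h_i+r_i$ if $0\le h_1+r_1\le h_2+r_2\le m+1$, and otherwise both heads stay. If $d_j=\mathtt r$, then $c_j$ becomes $0$ and $C_j$ becomes an arbitrary number in $\{0,\dots,m\}$, chosen nondeterministically; otherwise $C_j$ is unchanged and $c_j$ becomes $(c_j+d_j) \bmod (C_j+1)$. The language $L(M)$ is the set of all $w$ for which some sequence of moves leads from the initial configuration $(q_0,0,0,(0,0),\dots,(0,0))$ to a configuration with state in $F$. **Theorem.** For every terminal-free pattern $\alpha$ and every Janus operating mode $\Delta$ for $\alpha$, there is a Janus automaton $M$ over $\Sigma$ with exactly $\mathrm{cn}(\Delta)+1$ counters such that $L(M)=L(\alpha)$. -/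

import Mathlib

/-! ### Terminal-free patterns and their languages -/

/-- The pattern language of the terminal-free pattern `α` over the terminal alphabet `S`: all words
`σ(α)`, where the morphism `σ : X* → S*` is given by the (possibly empty) images of the variables. -/
def patternLanguage {X : Type*} (S : Type*) (α : List X) : Language S :=
  {w | ∃ σ : X → List S, w = α.flatMap σ}

/-- The variable `y_j` at position `j` of `α = y_1 ⋯ y_n`. Positions are counted from `1`;
the value is `none` unless `1 ≤ j ≤ n`. -/
def varAt {X : Type*} (α : List X) (j : ℕ) : Option X :=
  if j = 0 then none else α[j - 1]?

/-- The set of all positions of `α` at which the variable `x` occurs. -/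
def varPos {X : Type*} (α : List X) (x : X) : Set ℕ :=
  {j | varAt α j = some x}

/-! ### Matching orders -/

/-- The graph whose vertices are the positions of `x` in `α` and whose edges are the pairs in `L`. -/
def matchingGraph {X : Type*} (α : List X) (x : X) (L : List (ℕ × ℕ)) :
    SimpleGraph (varPos α x) :=
  SimpleGraph.fromRel fun a b => (a.1, b.1) ∈ L

/-- `L = ((l_1, r_1), …, (l_{n-1}, r_{n-1}))` is a matching order for the variable `x` in `α`, where
`n` is the number of occurrences of `x` in `α`. -/
def IsMatchingOrder {X : Type*} [DecidableEq X] (α : List X) (x : X) (L : List (ℕ × ℕ)) : Prop :=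
  L.length = α.count x - 1 ∧
  (∀ p ∈ L, p.1 ∈ varPos α x ∧ p.2 ∈ varPos α x ∧ p.1 < p.2) ∧
  (matchingGraph α x L).Connected

/-- `m` is a complete matching order for `α`: a sequence of length `∑ (n_x - 1)` that contains all
the elements of a family of matching orders `μ x`, one for each variable `x` of `α`. -/
def IsCompleteMatchingOrder {X : Type*} [DecidableEq X] (α : List X) (m : List (ℕ × ℕ)) : Prop :=
  ∃ μ : X → List (ℕ × ℕ),
    (∀ x ∈ α, IsMatchingOrder α x (μ x)) ∧
    m.length = ∑ x ∈ α.toFinset, (α.count x - 1) ∧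
    ∀ x ∈ α, ∀ p ∈ μ x, p ∈ m

/-! ### Janus operating modes -/

/-- The two markers: `left` for `λ` and `right` for `ρ`. -/
inductive Head where
  | left
  | right
  deriving DecidableEq

/-- The sequence `g(j, j')`: it is `(j + 1, …, j' - 1)` if `j < j'`, and `(j, j - 1, …, j')`
if `j' ≤ j`. After a match at position `j` a head stands behind the factor at `j`, so it has to be
moved back over this factor if `j' = j` as well. -/
def headPath (j j' : ℕ) : List ℕ :=
  if j < j' then List.range' (j + 1) (j' - 1 - j)
  else (List.range' j' (j + 1 - j')).reverse

/-- The elements of `D` that carry the marker `μ`, in their order, without the marker. -/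
def headTrack (μ : Head) (D : List (ℕ × Head)) : List ℕ :=
  (D.filter fun d => d.2 = μ).map Prod.fst

/-- The element with marker `μ` that is current after the entry of `D` with index `j` (counted from
`0`): the last one among the entries up to `j`, or, if there is none up to `j`, the first one in `D`.
It is `none` only if `D` has no element with marker `μ`. -/
def currentElem (μ : Head) (D : List (ℕ × Head)) (j : ℕ) : Option ℕ :=
  (headTrack μ (D.take (j + 1))).getLast?.or (headTrack μ D).head?

/-- `D` is an admissible sequence of head movements from the matching position `p = (l, r)` to the
matching position `p' = (l', r')`: it is a shuffle of `g(l, l')`, marked `λ`, and `g(r, r')`,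
marked `ρ`, in which the current left element never exceeds the current right element. -/
def IsHeadMovement (p p' : ℕ × ℕ) (D : List (ℕ × Head)) : Prop :=
  headTrack Head.left D = headPath p.1 p'.1 ∧
  headTrack Head.right D = headPath p.2 p'.2 ∧
  ∀ j < D.length, ∀ a ∈ currentElem Head.left D j, ∀ b ∈ currentElem Head.right D j, a ≤ b

/-- `DerivedFrom p m Δ`: the sequence `Δ = (D_1, …, D_k)` is derived from the sequence
`m = (m_1, …, m_k)` of matching positions, when `m_0 = p`. Each `D_i` consists of an admissible
sequence of head movements from `m_{i-1}` to `m_i = (l_i, r_i)`, followed by `(r_i, ρ), (l_i, λ)`. -/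
inductive DerivedFrom : ℕ × ℕ → List (ℕ × ℕ) → List (List (ℕ × Head)) → Prop
  | nil (p : ℕ × ℕ) : DerivedFrom p [] []
  | cons (p p' : ℕ × ℕ) (m : List (ℕ × ℕ)) (D : List (ℕ × Head)) (Δ : List (List (ℕ × Head))) :
      IsHeadMovement p p' D → DerivedFrom p' m Δ →
      DerivedFrom p (p' :: m) ((D ++ [(p'.2, Head.right), (p'.1, Head.left)]) :: Δ)

/-- `Δ` is a Janus operating mode for `α`. -/
def IsJanusOperatingMode {X : Type*} [DecidableEq X] (α : List X)
    (Δ : List (List (ℕ × Head))) : Prop :=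
  ∃ m : List (ℕ × ℕ), IsCompleteMatchingOrder α m ∧ DerivedFrom (0, 0) m Δ

/-- The variables different from the one at place `i` of the head movement indicator
`Δ.flatten = ((d_1, μ_1), (d_2, μ_2), …)` that occur both before and after that place. -/
def crossingVars {X : Type*} (α : List X) (Δ : List (List (ℕ × Head)))
    (i : Fin Δ.flatten.length) : Set X :=
  {x | (∃ j j' : Fin Δ.flatten.length, j < i ∧ i < j' ∧
      varAt α (Δ.flatten.get j).1 = some x ∧ varAt α (Δ.flatten.get j').1 = some x) ∧
    varAt α (Δ.flatten.get i).1 ≠ some x}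

/-- The counter number of `Δ`. The maximum over no places at all is `0`. -/
noncomputable def counterNumber {X : Type*} (α : List X) (Δ : List (List (ℕ × Head))) : ℕ :=
  Finset.univ.sup fun i : Fin Δ.flatten.length => (crossingVars α Δ i).ncard

/-! ### Janus automata -/

/-- The symbols of the input tape: the input symbols and the two endmarkers. -/
inductive TapeSymbol (S : Type*) where
  | leftEnd
  | letter (a : S)
  | rightEnd

/-- The counter messages: `eq` if the counter has reached its bound, `lt` otherwise. -/
inductive CounterMessage where
  | eq
  | lt

/-- The head instructions `-1`, `0`, `1`. -/
inductive HeadInstr where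
  | back
  | stay
  | forth

/-- The displacement of a head under an instruction. -/
def HeadInstr.val : HeadInstr → ℤ
  | .back => -1
  | .stay => 0
  | .forth => 1

/-- The counter instructions `0`, `1` and `r`. -/
inductive CounterInstr where
  | keep
  | incr
  | reset

/-- A Janus automaton with `k` counters over the input alphabet `S`. -/
structure JanusAutomaton (k : ℕ) (S : Type*) where
  State : Type
  finite_state : Finite State
  δ : State → TapeSymbol S → TapeSymbol S → (Fin k → CounterMessage) →
    State × HeadInstr × HeadInstr × (Fin k → CounterInstr)
  start : State
  accept : Set State

/-- The symbol at position `h` of the tape with the input word `w` between the two endmarkers, for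
`0 ≤ h ≤ |w| + 1`. -/
def tapeAt {S : Type*} (w : List S) (h : ℕ) : TapeSymbol S :=
  if h = 0 then .leftEnd
  else match w[h - 1]? with
    | some a => .letter a
    | none => .rightEnd

namespace JanusAutomaton

variable {k : ℕ} {S : Type*}

/-- The data of a configuration: the state, the two head positions, and the values and bounds of
the counters. -/
@[ext]
structure Config (M : JanusAutomaton k S) where
  state : M.State
  head₁ : ℕ
  head₂ : ℕ
  value : Fin k → ℕ
  bound : Fin k → ℕ

/-- The constraints on a configuration on the input word `w`. -/
def Config.Valid {M : JanusAutomaton k S} (w : List S) (c : M.Config) : Prop :=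
  c.head₁ ≤ c.head₂ ∧ c.head₂ ≤ w.length + 1 ∧
  ∀ j, c.value j ≤ c.bound j ∧ c.bound j ≤ w.length

/-- The message of counter `j` in a configuration. -/
def Config.message {M : JanusAutomaton k S} (c : M.Config) (j : Fin k) : CounterMessage :=
  if c.value j = c.bound j then .eq else .lt

/-- The initial configuration. -/
def init (M : JanusAutomaton k S) : M.Config where
  state := M.start
  head₁ := 0
  head₂ := 0
  value := fun _ => 0
  bound := fun _ => 0

/-- Whether both heads may be moved by `r₁`, `r₂` on an input of length `n`. -/
def MoveAllowed (n h₁ h₂ : ℕ) (r₁ r₂ : HeadInstr) : Prop :=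
  0 ≤ (h₁ : ℤ) + r₁.val ∧ (h₁ : ℤ) + r₁.val ≤ h₂ + r₂.val ∧ (h₂ : ℤ) + r₂.val ≤ n + 1

/-- The effect of an instruction on a counter with value `v` and bound `b`, on an input of
length `n`: the new value is `v'` and the new bound is `b'`. -/
def CounterStep (n v b : ℕ) : CounterInstr → ℕ → ℕ → Prop
  | .keep, v', b' => v' = v % (b + 1) ∧ b' = b
  | .incr, v', b' => v' = (v + 1) % (b + 1) ∧ b' = b
  | .reset, v', b' => v' = 0 ∧ b' ≤ n

open Classical in
/-- The atomic moves of `M` on the input word `w`. -/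
def Step (M : JanusAutomaton k S) (w : List S) (c c' : M.Config) : Prop :=
  ∃ (q : M.State) (r₁ r₂ : HeadInstr) (d : Fin k → CounterInstr),
    M.δ c.state (tapeAt w c.head₁) (tapeAt w c.head₂) c.message = (q, r₁, r₂, d) ∧
    c'.state = q ∧
    (c'.head₁ : ℤ) =
      (if MoveAllowed w.length c.head₁ c.head₂ r₁ r₂ then c.head₁ + r₁.val else c.head₁) ∧
    (c'.head₂ : ℤ) =
      (if MoveAllowed w.length c.head₁ c.head₂ r₁ r₂ then c.head₂ + r₂.val else c.head₂) ∧
    ∀ j, CounterStep w.length (c.value j) (c.bound j) (d j) (c'.value j) (c'.bound j)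

/-- The language accepted by `M`: the words on which `M` can reach an accepting state from its
initial configuration. -/
def language (M : JanusAutomaton k S) : Language S :=
  {w | ∃ c : M.Config, Relation.ReflTransGen (M.Step w) M.init c ∧ c.state ∈ M.accept}

theorem init_valid (M : JanusAutomaton k S) (w : List S) : M.init.Valid w := by
  simp [Config.Valid, init]

/-- Atomic moves lead from configurations to configurations, so that every configuration reached
by `M` on `w` satisfies the constraints. -/
theorem Step.valid {M : JanusAutomaton k S} {w : List S} {c c' : M.Config}
    (h : M.Step w c c') (hc : c.Valid w) : c'.Valid w := by
  obtain ⟨q, r₁, r₂, d, -, -, h₁, h₂, hd⟩ := h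
  obtain ⟨a, b, e⟩ := hc
  have key : c'.head₁ ≤ c'.head₂ ∧ c'.head₂ ≤ w.length + 1 := by
    split_ifs at h₁ h₂ with hm
    · obtain ⟨m₁, m₂, m₃⟩ := hm
      omega
    · omega
  refine ⟨key.1, key.2, fun j => ?_⟩
  have hj := hd j
  have ej := e j
  cases hdj : d j <;> rw [hdj] at hj <;> obtain ⟨hv, hb⟩ := hj
  · exact ⟨by rw [hv, hb]; exact Nat.lt_succ_iff.mp (Nat.mod_lt _ (Nat.succ_pos _)), hb ▸ ej.2⟩
  · exact ⟨by rw [hv, hb]; exact Nat.lt_succ_iff.mp (Nat.mod_lt _ (Nat.succ_pos _)), hb ▸ ej.2⟩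
  · exact ⟨by rw [hv]; exact Nat.zero_le _, hb⟩

end JanusAutomaton

/-! ### Programs for Janus automata -/

/-! A word lies in the pattern language iff the variables can be given lengths such that the factors
cut out of the word agree at all positions of each variable. It suffices to compare the pairs of a
matching order, because its graph is connected on the positions of each variable. The automaton
guesses the length of a variable by a counter reset when the variable first appears in Δ, and then
follows Δ: crossing a factor is a loop governed by the counter of its variable, and matching a pair
moves both heads together over equal letters. The guesses are the only nondeterminism.

A length must be stored only between the first and last entries of its variable in Δ. When a
variable first appears, at most cn(Δ) others are live, so a greedy choice among cn(Δ) + 1 counters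
always succeeds (`ncard_le_counterNumber`, `exists_isAllocation`), and reusing counters in this way
is harmless (`accepting_compile`).

The heads must not cross. A mode may let both heads pass the same factor with the wrong head listed
first; the two entries name the same variable, so they can be exchanged
(`DerivedFrom.exists_legal`). `Legal.factorsMatch` and `Legal.runs` are then soundness and
completeness of the movements. Counting shows that a complete matching order has no room for foreign
pairs (`IsCompleteMatchingOrder.valid`). Factors that were never compared may have meaningless
lengths; `mem_patternLanguage_of_factorsMatch` truncates them and lets the last one absorb the rest
of the input. -/

/-- Conditions on the two scanned symbols. -/
inductive Guard where
  | any
  | letter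
  | same
  | atEnd

/-- Whether a condition holds for the symbols scanned by the left and the right head. -/
def Guard.Holds {S : Type*} : Guard → TapeSymbol S → TapeSymbol S → Prop
  | .any, _, _ => True
  | .letter, _, b => ∃ s, b = .letter s
  | .same, a, b => ∃ s, a = .letter s ∧ b = .letter s
  | .atEnd, _, b => b = .rightEnd

/-- The instructions of a program: reset a counter; move the heads under a guard once for every
unit of the bound of a counter; move the heads once under a guard. -/
inductive Op (k : ℕ) where
  | reset (j : Fin k)
  | loop (j : Fin k) (r₁ r₂ : HeadInstr) (g : Guard)
  | step (r₁ r₂ : HeadInstr) (g : Guard)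

namespace JanusAutomaton

variable {k : ℕ} {S : Type*}

open Classical in
/-- The transition function that executes a program; `none` is the rejecting state. -/
noncomputable def programStep (prog : List (Op k)) :
    Option {l : List (Op k) // l <:+ prog} → TapeSymbol S → TapeSymbol S →
      (Fin k → CounterMessage) →
      Option {l : List (Op k) // l <:+ prog} × HeadInstr × HeadInstr × (Fin k → CounterInstr)
  | none, _, _, _ => (none, .stay, .stay, fun _ => .keep)
  | some ⟨[], h⟩, _, _, _ => (some ⟨[], h⟩, .stay, .stay, fun _ => .keep)
  | some ⟨.reset j :: l, h⟩, _, _, _ =>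
      (some ⟨l, (List.suffix_cons _ _).trans h⟩, .stay, .stay,
        Function.update (fun _ => .keep) j .reset)
  | some ⟨.loop j r₁ r₂ g :: l, h⟩, a, b, m =>
      -- Incrementing at the bound wraps the value to 0, so all counter values are 0 between
      -- instructions.
      if m j = .eq then
        (some ⟨l, (List.suffix_cons _ _).trans h⟩, .stay, .stay,
          Function.update (fun _ => .keep) j .incr)
      else if g.Holds a b then
        (some ⟨.loop j r₁ r₂ g :: l, h⟩, r₁, r₂, Function.update (fun _ => .keep) j .incr)
      else (none, .stay, .stay, fun _ => .keep)
  | some ⟨.step r₁ r₂ g :: l, h⟩, a, b, _ =>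
      if g.Holds a b then
        (some ⟨l, (List.suffix_cons _ _).trans h⟩, r₁, r₂, fun _ => .keep)
      else (none, .stay, .stay, fun _ => .keep)

theorem finite_suffixes {A : Type*} (prog : List A) : Finite {l : List A // l <:+ prog} := by
  have : {l : List A | l <:+ prog} = {l | l ∈ prog.tails} := by
    ext l; simp
  have h : {l : List A | l <:+ prog}.Finite := by
    rw [this]; exact List.finite_toSet _
  exact h

/-- The automaton that executes a program and accepts at its end. -/
noncomputable def ofProgram (S : Type*) (prog : List (Op k)) : JanusAutomaton k S where
  State := Option {l : List (Op k) // l <:+ prog}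
  finite_state := by
    have := finite_suffixes prog
    infer_instance
  δ := programStep prog
  start := some ⟨prog, List.suffix_refl _⟩
  accept := {some ⟨[], List.nil_suffix⟩}

open Classical in
/-- The effect of head instructions on the pair of head positions, on an input of length `n`. -/
noncomputable def moveHeads (n : ℕ) (r₁ r₂ : HeadInstr) (h : ℕ × ℕ) : ℕ × ℕ :=
  if MoveAllowed n h.1 h.2 r₁ r₂ then (((h.1 : ℤ) + r₁.val).toNat, ((h.2 : ℤ) + r₂.val).toNat)
  else h

@[simp]
theorem moveHeads_stay (n : ℕ) (h : ℕ × ℕ) : moveHeads n .stay .stay h = h := by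
  unfold moveHeads
  split_ifs <;> simp [HeadInstr.val]

/-- An accepting configuration can be reached from `c`. -/
def Accepting (M : JanusAutomaton k S) (w : List S) (c : M.Config) : Prop :=
  ∃ c' : M.Config, Relation.ReflTransGen (M.Step w) c c' ∧ c'.state ∈ M.accept

theorem accepting_iff (M : JanusAutomaton k S) (w : List S) (c : M.Config) :
    M.Accepting w c ↔ c.state ∈ M.accept ∨ ∃ c', M.Step w c c' ∧ M.Accepting w c' := by
  constructor
  · rintro ⟨c', h, hc'⟩
    rcases Relation.ReflTransGen.cases_head h with rfl | ⟨d, h₁, h₂⟩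
    · exact .inl hc'
    · exact .inr ⟨d, h₁, c', h₂, hc'⟩
  · rintro (h | ⟨d, h₁, c', h₂, hc'⟩)
    · exact ⟨c, .refl, h⟩
    · exact ⟨c', .head h₁ h₂, hc'⟩

open Classical in
theorem step_iff (M : JanusAutomaton k S) (w : List S) (c c' : M.Config)
    {q : M.State} {r₁ r₂ : HeadInstr} {d : Fin k → CounterInstr}
    (h : M.δ c.state (tapeAt w c.head₁) (tapeAt w c.head₂) c.message = (q, r₁, r₂, d)) :
    M.Step w c c' ↔ c'.state = q ∧
      (c'.head₁, c'.head₂) = moveHeads w.length r₁ r₂ (c.head₁, c.head₂) ∧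
      ∀ j, CounterStep w.length (c.value j) (c.bound j) (d j) (c'.value j) (c'.bound j) := by
  have key : ((c'.head₁ : ℤ) =
      (if MoveAllowed w.length c.head₁ c.head₂ r₁ r₂ then c.head₁ + r₁.val else c.head₁) ∧
    (c'.head₂ : ℤ) =
      (if MoveAllowed w.length c.head₁ c.head₂ r₁ r₂ then c.head₂ + r₂.val else c.head₂)) ↔
      (c'.head₁, c'.head₂) = moveHeads w.length r₁ r₂ (c.head₁, c.head₂) := by
    unfold moveHeads
    split_ifs with hm
    · obtain ⟨h₁, h₂, h₃⟩ := hm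
      simp only [Prod.mk.injEq]
      omega
    · simp
  unfold Step
  constructor
  · rintro ⟨q', r₁', r₂', d', h', e₁, e₂, e₃, e₄⟩
    rw [h] at h'
    simp only [Prod.mk.injEq] at h'
    obtain ⟨rfl, rfl, rfl, rfl⟩ := h'
    exact ⟨e₁, key.1 ⟨e₂, e₃⟩, e₄⟩
  · rintro ⟨e₁, e₂, e₃⟩
    exact ⟨q, r₁, r₂, d, h, e₁, (key.2 e₂).1, (key.2 e₂).2, e₃⟩

/-- A move with a unique outcome. -/
theorem accepting_of_unique (M : JanusAutomaton k S) (w : List S) (c c₁ : M.Config)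
    {q : M.State} {r₁ r₂ : HeadInstr} {d : Fin k → CounterInstr}
    (h : M.δ c.state (tapeAt w c.head₁) (tapeAt w c.head₂) c.message = (q, r₁, r₂, d))
    (hc : c.state ∉ M.accept) (hq : c₁.state = q)
    (hh : (c₁.head₁, c₁.head₂) = moveHeads w.length r₁ r₂ (c.head₁, c.head₂))
    (hv : ∀ j v b, CounterStep w.length (c.value j) (c.bound j) (d j) v b ↔
      v = c₁.value j ∧ b = c₁.bound j) :
    M.Accepting w c ↔ M.Accepting w c₁ := by
  rw [accepting_iff]
  simp only [hc, false_or, M.step_iff w c _ h, hv, ← hh, ← hq]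
  constructor
  · rintro ⟨c', ⟨e₁, e₂, e₃⟩, h'⟩
    simp only [Prod.mk.injEq] at e₂
    have : c' = c₁ := Config.ext e₁ e₂.1 e₂.2 (funext fun j => (e₃ j).1) (funext fun j => (e₃ j).2)
    exact this ▸ h'
  · exact fun h' => ⟨c₁, ⟨rfl, rfl, fun _ => ⟨rfl, rfl⟩⟩, h'⟩

theorem not_accepting_none (prog : List (Op k)) (w : List S) (c : (ofProgram S prog).Config)
    (hc : c.state = none) : ¬ (ofProgram S prog).Accepting w c := by
  rintro ⟨c', h, h'⟩
  have : c'.state = none := by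
    clear h'
    induction h with
    | refl => exact hc
    | tail _ hs ih =>
      obtain ⟨q, r₁, r₂, d, h₁, h₂, -⟩ := hs
      rw [ih] at h₁
      rw [h₂]
      exact (congrArg Prod.fst h₁).symm
  rw [this] at h'
  exact Option.some_ne_none _ (show none = some _ from h').symm

/-- The configuration of a program with a given remaining program. -/
def programConfig (S : Type*) {prog : List (Op k)} (l : List (Op k)) (hl : l <:+ prog) (h : ℕ × ℕ)
    (v B : Fin k → ℕ) : (ofProgram S prog).Config :=
  ⟨some ⟨l, hl⟩, h.1, h.2, v, B⟩

theorem accepting_nil {prog : List (Op k)} (w : List S) (hl : [] <:+ prog) (h : ℕ × ℕ)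
    (v B : Fin k → ℕ) : (ofProgram S prog).Accepting w (programConfig S [] hl h v B) :=
  ⟨_, .refl, rfl⟩

theorem cons_notMem_accept {prog : List (Op k)} (o : Op k) (l : List (Op k)) (hl : o :: l <:+ prog) :
    (some ⟨o :: l, hl⟩ : (ofProgram S prog).State) ∉ (ofProgram S prog).accept := by
  intro h
  have : (some ⟨o :: l, hl⟩ : Option {l : List (Op k) // l <:+ prog}) =
    some ⟨[], List.nil_suffix⟩ := h
  simp at this

theorem counterStep_keep_iff {n v b v' b' : ℕ} (h : v ≤ b) :
    CounterStep n v b .keep v' b' ↔ v' = v ∧ b' = b := by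
  simp [CounterStep, Nat.mod_eq_of_lt (Nat.lt_succ_of_le h)]

theorem accepting_step {prog : List (Op k)} (w : List S) (r₁ r₂ : HeadInstr) (g : Guard)
    (l : List (Op k)) (hl : .step r₁ r₂ g :: l <:+ prog) (h : ℕ × ℕ) (B : Fin k → ℕ) :
    (ofProgram S prog).Accepting w (programConfig S _ hl h 0 B) ↔
      g.Holds (tapeAt w h.1) (tapeAt w h.2) ∧ (ofProgram S prog).Accepting w
        (programConfig S l ((List.suffix_cons _ _).trans hl) (moveHeads w.length r₁ r₂ h) 0 B) := by
  by_cases hg : g.Holds (tapeAt w h.1) (tapeAt w h.2)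
  · simp only [hg, true_and]
    refine accepting_of_unique (d := fun _ => .keep) (r₁ := r₁) (r₂ := r₂) _ w _ _ ?_
      (cons_notMem_accept _ _ hl) rfl rfl ?_
    · simp [ofProgram, programConfig, programStep, hg]
    · intro j v b
      exact counterStep_keep_iff (Nat.zero_le _)
  · simp only [hg, false_and, iff_false]
    rw [accepting_of_unique (d := fun _ => .keep) (r₁ := .stay) (r₂ := .stay) (q := none)
      (c₁ := ⟨none, h.1, h.2, 0, B⟩) _ w _ ?_ (cons_notMem_accept _ _ hl) rfl ?_ ?_]
    · exact not_accepting_none _ _ _ rfl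
    · simp [ofProgram, programConfig, programStep, hg]
    · simp [programConfig]
    · intro j v b
      exact counterStep_keep_iff (Nat.zero_le _)

theorem accepting_reset {prog : List (Op k)} (w : List S) (j : Fin k)
    (l : List (Op k)) (hl : .reset j :: l <:+ prog) (h : ℕ × ℕ) (B : Fin k → ℕ) :
    (ofProgram S prog).Accepting w (programConfig S _ hl h 0 B) ↔
      ∃ b ≤ w.length, (ofProgram S prog).Accepting w
        (programConfig S l ((List.suffix_cons _ _).trans hl) h 0 (Function.update B j b)) := by
  have hδ : (ofProgram S prog).δ (programConfig S _ hl h 0 B).state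
      (tapeAt w (programConfig S _ hl h 0 B).head₁) (tapeAt w (programConfig S _ hl h 0 B).head₂)
      (programConfig S _ hl h 0 B).message = (some ⟨l, (List.suffix_cons _ _).trans hl⟩,
        .stay, .stay, Function.update (fun _ => .keep) j .reset) := by
    simp [ofProgram, programConfig, programStep]
  rw [accepting_iff]
  have := cons_notMem_accept (S := S) _ _ hl
  constructor
  · rintro (h' | ⟨c', hc, hacc⟩)
    · exact absurd h' this
    · obtain ⟨e₁, e₂, e₃⟩ := (step_iff _ w _ c' hδ).1 hc
      simp only [programConfig, moveHeads_stay, Prod.mk.injEq] at e₂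
      have ej := e₃ j
      simp only [Function.update_self, CounterStep] at ej
      refine ⟨c'.bound j, ej.2, ?_⟩
      convert hacc using 1
      refine Config.ext e₁.symm e₂.1.symm e₂.2.symm (funext fun i => ?_) (funext fun i => ?_)
      · have ei := e₃ i
        rcases eq_or_ne i j with rfl | hij
        · simp [programConfig, ej.1]
        · simp only [Function.update_of_ne hij, programConfig] at ei
          exact ((counterStep_keep_iff (Nat.zero_le _)).1 ei).1.symm
      · have ei := e₃ i
        rcases eq_or_ne i j with rfl | hij
        · simp [programConfig]
        · simp only [Function.update_of_ne hij, programConfig] at ei ⊢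
          exact ((counterStep_keep_iff (Nat.zero_le _)).1 ei).2.symm
  · rintro ⟨b, hb, hacc⟩
    refine .inr ⟨_, (step_iff _ w _ _ hδ).2 ⟨rfl, by simp [programConfig], fun i => ?_⟩, hacc⟩
    rcases eq_or_ne i j with rfl | hij
    · simp [programConfig, CounterStep, hb]
    · simp only [Function.update_of_ne hij, programConfig]
      exact (counterStep_keep_iff (Nat.zero_le _)).2 ⟨rfl, rfl⟩

/-- Induction on the number `N` of rounds left: the value `a` grows as `N` shrinks, so the bound is
met exactly when no round is left. -/
theorem accepting_loop {prog : List (Op k)} (w : List S) (j : Fin k) (r₁ r₂ : HeadInstr) (g : Guard)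
    (l : List (Op k)) (hl : .loop j r₁ r₂ g :: l <:+ prog) (B : Fin k → ℕ) (N : ℕ) :
    ∀ (h : ℕ × ℕ) (a : ℕ), a + N = B j →
    ((ofProgram S prog).Accepting w (programConfig S _ hl h (Function.update 0 j a) B) ↔
      (∀ s < N, g.Holds (tapeAt w ((moveHeads w.length r₁ r₂)^[s] h).1)
        (tapeAt w ((moveHeads w.length r₁ r₂)^[s] h).2)) ∧
      (ofProgram S prog).Accepting w (programConfig S l ((List.suffix_cons _ _).trans hl)
        ((moveHeads w.length r₁ r₂)^[N] h) 0 B)) := by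
  have hval : ∀ (a : ℕ), a ≤ B j → ∀ i, (Function.update 0 j a : Fin k → ℕ) i ≤ B i := by
    intro a ha i
    rcases eq_or_ne i j with rfl | hij
    · simpa using ha
    · simp [Function.update_of_ne hij]
  induction N with
  | zero =>
    intro h a ha
    simp only [Nat.not_lt_zero, false_imp_iff, imp_true_iff, true_and, Function.iterate_zero, id]
    refine accepting_of_unique (d := Function.update (fun _ => .keep) j .incr) (r₁ := .stay)
      (r₂ := .stay) _ w _ _ ?_ (cons_notMem_accept _ _ hl) rfl (by simp [programConfig]) ?_
    · have : (programConfig S _ hl h (Function.update 0 j a) B).message j = .eq := by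
        simp [Config.message, programConfig]; omega
      simp only [ofProgram, programConfig, programStep] at this ⊢
      rw [if_pos this]
    · intro i v b
      rcases eq_or_ne i j with rfl | hij
      · have : a = B i := by omega
        simp [programConfig, CounterStep, this]
      · simp only [Function.update_of_ne hij, programConfig]
        exact counterStep_keep_iff (Nat.zero_le _)
  | succ N ih =>
    intro h a ha
    have hm : (programConfig S _ hl h (Function.update 0 j a) B).message j ≠ .eq := by
      simp [Config.message, programConfig]; omega
    rw [Nat.forall_lt_succ_left]
    simp only [Function.iterate_zero, id, Function.iterate_succ, Function.comp_apply]
    by_cases hg : g.Holds (tapeAt w h.1) (tapeAt w h.2)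
    · simp only [hg, true_and]
      rw [← ih (moveHeads w.length r₁ r₂ h) (a + 1) (by omega)]
      refine accepting_of_unique (d := Function.update (fun _ => .keep) j .incr) (r₁ := r₁)
        (r₂ := r₂) _ w _ _ ?_ (cons_notMem_accept _ _ hl) rfl rfl ?_
      · simp only [ofProgram, programConfig, programStep] at hm ⊢
        rw [if_neg hm, if_pos hg]
      · intro i v b
        rcases eq_or_ne i j with rfl | hij
        · have : (a + 1) % (B i + 1) = a + 1 := Nat.mod_eq_of_lt (by omega)
          simp [programConfig, CounterStep, this]
        · simp only [Function.update_of_ne hij, programConfig]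
          exact counterStep_keep_iff (Nat.zero_le _)
    · simp only [hg, false_and, iff_false]
      rw [accepting_of_unique (d := fun _ => .keep) (r₁ := .stay) (r₂ := .stay) (q := none)
        (c₁ := ⟨none, h.1, h.2, Function.update 0 j a, B⟩) _ w _ ?_ (cons_notMem_accept _ _ hl)
        rfl ?_ ?_]
      · exact not_accepting_none _ _ _ rfl
      · simp only [ofProgram, programConfig, programStep] at hm ⊢
        rw [if_neg hm, if_neg hg]
      · simp [programConfig]
      · intro i v b
        exact counterStep_keep_iff (hval a (by omega) i)

theorem accepting_loop_zero {prog : List (Op k)} (w : List S) (j : Fin k) (r₁ r₂ : HeadInstr)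
    (g : Guard) (l : List (Op k)) (hl : .loop j r₁ r₂ g :: l <:+ prog) (B : Fin k → ℕ)
    (h : ℕ × ℕ) :
    (ofProgram S prog).Accepting w (programConfig S _ hl h 0 B) ↔
      (∀ s < B j, g.Holds (tapeAt w ((moveHeads w.length r₁ r₂)^[s] h).1)
        (tapeAt w ((moveHeads w.length r₁ r₂)^[s] h).2)) ∧
      (ofProgram S prog).Accepting w (programConfig S l ((List.suffix_cons _ _).trans hl)
        ((moveHeads w.length r₁ r₂)^[B j] h) 0 B) := by
  rw [← accepting_loop w j r₁ r₂ g l hl B (B j) h 0 (zero_add _),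
    show Function.update (0 : Fin k → ℕ) j 0 = 0 from Function.update_eq_self j 0]

end JanusAutomaton

/-! ### Actions governed by the lengths of variables -/

/-- An action of a head movement that is governed by the length of a variable: to move the heads
under a guard as many times as this length says, or only to test a guard. -/
inductive Act where
  | loop (r₁ r₂ : HeadInstr) (g : Guard)
  | test (g : Guard)

/-- The instruction that performs an action if a counter stores the length of the variable. -/
def Act.op {k : ℕ} (j : Fin k) : Act → Op k
  | .loop r₁ r₂ g => .loop j r₁ r₂ g
  | .test g => .step .stay .stay g

open JanusAutomaton

section Patterns

variable {X S : Type*}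

/-- The sequence `I` of actions can be performed from the head positions `h` if the variables have
the lengths `ℓ`. -/
def Runs (w : List S) (ℓ : X → ℕ) : List (X × Act) → ℕ × ℕ → Prop
  | [], _ => True
  | (x, .loop r₁ r₂ g) :: I, h =>
      (∀ s < ℓ x, g.Holds (tapeAt w ((moveHeads w.length r₁ r₂)^[s] h).1)
        (tapeAt w ((moveHeads w.length r₁ r₂)^[s] h).2)) ∧
      Runs w ℓ I ((moveHeads w.length r₁ r₂)^[ℓ x] h)
  | (_, .test g) :: I, h => g.Holds (tapeAt w h.1) (tapeAt w h.2) ∧ Runs w ℓ I h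

theorem Runs.congr {w : List S} {ℓ ℓ' : X → ℕ} {I : List (X × Act)} {h : ℕ × ℕ}
    (hI : Runs w ℓ I h) (hℓ : ∀ x ∈ I.map Prod.fst, ℓ x = ℓ' x) : Runs w ℓ' I h := by
  induction I generalizing h with
  | nil => trivial
  | cons e I ih =>
    obtain ⟨x, a⟩ := e
    have hx : ℓ x = ℓ' x := hℓ x (by simp)
    cases a with
    | loop r₁ r₂ g =>
      simp only [Runs, ← hx] at hI ⊢
      exact ⟨hI.1, ih hI.2 fun y hy => hℓ y (List.mem_cons_of_mem _ hy)⟩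
    | test g => exact ⟨hI.1, ih hI.2 fun y hy => hℓ y (List.mem_cons_of_mem _ hy)⟩

/-- Variables that are in use at the same time in the sequence `v` have different counters. -/
def IsAllocation {k : ℕ} (c : X → Fin k) (v : List X) : Prop :=
  ∀ p x s, v = p ++ x :: s → x ∉ p → ∀ z ∈ p, z ∈ s → c z ≠ c x

theorem accepting_op {k : ℕ} {prog : List (Op k)} (w : List S) (ℓ : X → ℕ) (j : Fin k)
    (B : Fin k → ℕ) (x : X) (a : Act) (hx : ℓ x = B j) (l : List (Op k))
    (hl : a.op j :: l <:+ prog) (I : List (X × Act)) (h : ℕ × ℕ)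
    (hI : ∀ h, Runs w ℓ I h → (ofProgram S prog).Accepting w
      (programConfig S l ((List.suffix_cons _ _).trans hl) h 0 B))
    (hr : Runs w ℓ ((x, a) :: I) h) :
    (ofProgram S prog).Accepting w (programConfig S _ hl h 0 B) := by
  cases a with
  | loop r₁ r₂ g =>
    exact (accepting_loop_zero w j r₁ r₂ g l hl B h).2
      ⟨by rw [← hx]; exact hr.1, hI _ (by rw [← hx]; exact hr.2)⟩
  | test g =>
    refine (accepting_step w _ _ g l hl h B).2 ⟨hr.1, ?_⟩
    rw [moveHeads_stay]
    exact hI _ hr.2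

/-- The lengths are supplied by the continuation, so any property `P` of them passes through the
current action. -/
theorem runs_of_accepting_op {k : ℕ} {prog : List (Op k)} (w : List S) (j : Fin k)
    (B : Fin k → ℕ) (x : X) (a : Act) (l : List (Op k))
    (hl : a.op j :: l <:+ prog) (I : List (X × Act)) (h : ℕ × ℕ) (P : (X → ℕ) → Prop)
    (hI : ∀ h, (ofProgram S prog).Accepting w
      (programConfig S l ((List.suffix_cons _ _).trans hl) h 0 B) →
        ∃ ℓ, P ℓ ∧ ℓ x = B j ∧ Runs w ℓ I h)
    (hacc : (ofProgram S prog).Accepting w (programConfig S _ hl h 0 B)) :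
    ∃ ℓ, P ℓ ∧ ℓ x = B j ∧ Runs w ℓ ((x, a) :: I) h := by
  cases a with
  | loop r₁ r₂ g =>
    have := (accepting_loop_zero w j r₁ r₂ g l hl B h).1 hacc
    obtain ⟨ℓ, h₁, h₂, h₃⟩ := hI _ this.2
    exact ⟨ℓ, h₁, h₂, by rw [h₂]; exact this.1, by rw [h₂]; exact h₃⟩
  | test g =>
    have := (accepting_step w _ _ g l hl h B).1 hacc
    rw [moveHeads_stay] at this
    obtain ⟨ℓ, h₁, h₂, h₃⟩ := hI _ this.2
    exact ⟨ℓ, h₁, h₂, this.1, h₃⟩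

/-! ### Compilation of action sequences with reused counters -/

section Compile

variable [DecidableEq X]

/-- The program for the sequence `I` of actions, when the variables in `p` have been used already
and the lengths are stored as given by `c`. -/
def compile {k : ℕ} (c : X → Fin k) : List X → List (X × Act) → List (Op k)
  | _, [] => []
  | p, (x, a) :: I => (if x ∈ p then [] else [.reset (c x)]) ++
      a.op (c x) :: compile c (p ++ [x]) I

/-- The invariant constrains only the counters of variables that were used before and are needed
again. At a first use the guessed bound plays the role of `ℓ x`, and `IsAllocation` ensures that the
reset overwrites no live length. -/
theorem accepting_compile {k : ℕ} {prog : List (Op k)} (w : List S) {c : X → Fin k} {v : List X}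
    (hc : IsAllocation c v) (I : List (X × Act)) :
    ∀ (p : List X), v = p ++ I.map Prod.fst → ∀ (hl : compile c p I <:+ prog) (h : ℕ × ℕ)
      (B : Fin k → ℕ), (∀ j, B j ≤ w.length) →
    ((ofProgram S prog).Accepting w (programConfig S _ hl h 0 B) ↔
      ∃ ℓ : X → ℕ, ((∀ x, ℓ x ≤ w.length) ∧
        (∀ z ∈ p, z ∈ I.map Prod.fst → ℓ z = B (c z))) ∧ Runs w ℓ I h) := by
  induction I with
  | nil =>
    intro p _ hl h B _
    exact ⟨fun _ => ⟨0, ⟨fun _ => Nat.zero_le _, by simp⟩, trivial⟩, fun _ => accepting_nil w hl h 0 B⟩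
  | cons e I ih =>
    obtain ⟨x, a⟩ := e
    intro p hv
    have ih' := ih (p ++ [x]) (by simpa using hv)
    -- The action itself, once the counter of `x` holds its length; a preceding reset is treated
    -- separately.
    have main : ∀ (hl : a.op (c x) :: compile c (p ++ [x]) I <:+ prog) (h : ℕ × ℕ)
        (B : Fin k → ℕ), (∀ j, B j ≤ w.length) →
        ((ofProgram S prog).Accepting w (programConfig S _ hl h 0 B) ↔
        ∃ ℓ : X → ℕ, ((∀ x, ℓ x ≤ w.length) ∧
          (∀ z ∈ p, z ∈ I.map Prod.fst → ℓ z = B (c z))) ∧ ℓ x = B (c x) ∧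
            Runs w ℓ ((x, a) :: I) h) := by
      intro hl h B hB
      constructor
      · refine runs_of_accepting_op w (c x) B x a _ hl I h _ fun h' hacc => ?_
        obtain ⟨ℓ, ⟨h₁, h₂⟩, h₃⟩ := (ih' _ h' B hB).1 hacc
        -- If `x` does not occur again, the induction hypothesis leaves `ℓ x` arbitrary, so it is
        -- set to the stored value; otherwise the two already agree.
        refine ⟨Function.update ℓ x (B (c x)), ⟨fun y => ?_, fun z hz hz' => ?_⟩, by simp,
          h₃.congr fun y hy => ?_⟩
        · rcases eq_or_ne y x with rfl | hy
          · simpa using hB _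
          · simpa [Function.update_of_ne hy] using h₁ y
        · rcases eq_or_ne z x with rfl | hzx
          · simp
          · simpa [Function.update_of_ne hzx] using h₂ z (by simp [hz]) hz'
        · rcases eq_or_ne y x with rfl | hyx
          · simpa using h₂ y (by simp) hy
          · simp [Function.update_of_ne hyx]
      · rintro ⟨ℓ, ⟨h₁, h₂⟩, h₃, h₄⟩
        refine accepting_op w ℓ (c x) B x a h₃ _ hl I h (fun h' hr => ?_) h₄
        refine (ih' _ h' B hB).2 ⟨ℓ, ⟨h₁, fun z hz hz' => ?_⟩, hr⟩
        rcases List.mem_append.1 hz with hz | hz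
        · exact h₂ z hz hz'
        · rw [List.mem_singleton.1 hz, h₃]
    by_cases hx : x ∈ p
    · simp only [compile, hx, if_true, List.nil_append]
      intro hl h B hB
      rw [main hl h B hB]
      constructor
      · rintro ⟨ℓ, ⟨h₁, h₂⟩, h₃, h₄⟩
        refine ⟨ℓ, ⟨h₁, fun z hz hz' => ?_⟩, h₄⟩
        rcases eq_or_ne z x with rfl | hzx
        · exact h₃
        · exact h₂ z hz (by simpa [hzx] using hz')
      · rintro ⟨ℓ, ⟨h₁, h₂⟩, h₄⟩
        exact ⟨ℓ, ⟨h₁, fun z hz hz' => h₂ z hz (List.mem_cons_of_mem _ hz')⟩,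
          h₂ x hx (by simp), h₄⟩
    · simp only [compile, hx, if_false, List.singleton_append]
      intro hl h B hB
      rw [accepting_reset]
      have hB' : ∀ b ≤ w.length, ∀ j, Function.update B (c x) b j ≤ w.length := by
        intro b hb j
        rcases eq_or_ne j (c x) with rfl | hj
        · simpa using hb
        · simpa [Function.update_of_ne hj] using hB j
      have hne : ∀ z ∈ p, z ∈ I.map Prod.fst → c z ≠ c x := hc p x _ hv hx
      constructor
      · rintro ⟨b, hb, hacc⟩
        obtain ⟨ℓ, ⟨h₁, h₂⟩, h₃, h₄⟩ := (main _ h _ (hB' b hb)).1 hacc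
        refine ⟨ℓ, ⟨h₁, fun z hz hz' => ?_⟩, h₄⟩
        have hzx : z ≠ x := fun hzx => hx (hzx ▸ hz)
        have hz'' : z ∈ I.map Prod.fst := by simpa [hzx] using hz'
        rw [h₂ z hz hz'', Function.update_of_ne (hne z hz hz'')]
      · rintro ⟨ℓ, ⟨h₁, h₂⟩, h₄⟩
        refine ⟨ℓ x, h₁ x, (main _ h _ (hB' _ (h₁ x))).2
          ⟨ℓ, ⟨h₁, fun z hz hz' => ?_⟩, by simp, h₄⟩⟩
        rw [Function.update_of_ne (hne z hz hz')]
        exact h₂ z hz (List.mem_cons_of_mem _ hz')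

/-- The automaton with the counters allocated by `c` that performs a sequence of actions, starting
with both heads on the first symbol of the input, accepts if this is possible for some lengths. -/
theorem mem_language_compile {k : ℕ} {c : X → Fin k} (I : List (X × Act))
    (hc : IsAllocation c (I.map Prod.fst)) (w : List S) :
    w ∈ (ofProgram S (.step .forth .forth .any :: compile c [] I)).language ↔
      ∃ ℓ : X → ℕ, (∀ x, ℓ x ≤ w.length) ∧ Runs w ℓ I (1, 1) := by
  have h0 : moveHeads w.length .forth .forth (0, 0) = (1, 1) := by
    rw [moveHeads, if_pos]
    · simp [HeadInstr.val]
    · simp [MoveAllowed, HeadInstr.val]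
  have h1 := accepting_step (S := S) w .forth .forth .any _ (List.suffix_refl _) (0, 0)
    (fun _ => 0 : Fin k → ℕ) (prog := .step .forth .forth .any :: compile c [] I)
  rw [h0, accepting_compile w hc I [] (by simp) _ _ _ (by simp)] at h1
  simp only [Guard.Holds, true_and, List.not_mem_nil, false_imp_iff, imp_true_iff, and_true] at h1
  exact h1

end Compile

/-! ### Head movements between the factors -/

theorem tapeAt_succ_of_lt {w : List S} {i : ℕ} (h : i < w.length) :
    tapeAt w (i + 1) = .letter w[i] := by
  simp [tapeAt, h]

theorem tapeAt_length_succ (w : List S) : tapeAt w (w.length + 1) = .rightEnd := by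
  simp [tapeAt]

theorem tapeAt_eq_rightEnd_iff {w : List S} {i : ℕ} (h : i ≤ w.length) :
    tapeAt w (i + 1) = .rightEnd ↔ i = w.length := by
  constructor
  · intro h'
    by_contra hne
    rw [tapeAt_succ_of_lt (by omega)] at h'
    cases h'
  · rintro rfl
    exact tapeAt_length_succ w

/-- The head constraints are linear inequalities, so if both ends of a uniform motion satisfy them,
no move in between is blocked. -/
theorem moveHeads_iterate (n : ℕ) (r₁ r₂ : HeadInstr) (N : ℕ) :
    ∀ {a b a' b' : ℕ}, a ≤ b → b ≤ n + 1 → a' ≤ b' → b' ≤ n + 1 →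
      (a' : ℤ) = a + N * r₁.val → (b' : ℤ) = b + N * r₂.val →
      (moveHeads n r₁ r₂)^[N] (a, b) = (a', b') := by
  induction N with
  | zero =>
    intro a b a' b' _ _ _ _ h₁ h₂
    simp at h₁ h₂
    simp [h₁, h₂]
  | succ N ih =>
    intro a b a' b' hab hb hab' hb' h₁ h₂
    have hm : MoveAllowed n a b r₁ r₂ := by
      unfold MoveAllowed
      cases r₁ <;> cases r₂ <;> simp only [HeadInstr.val] at * <;> push_cast at * <;> omega
    rw [Function.iterate_succ_apply, moveHeads, if_pos hm]
    obtain ⟨h₃, h₄, h₅⟩ := hm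
    apply ih
    · simp only; omega
    · simp only; omega
    · exact hab'
    · exact hb'
    · rw [Int.toNat_of_nonneg h₃, h₁]; push_cast; ring
    · rw [Int.toNat_of_nonneg (h₃.trans h₄), h₂]; push_cast; ring

/-! ### Factor boundaries as head positions -/

/-- The length of the first `g` factors. -/
def offset (ℓ : X → ℕ) (α : List X) (g : ℕ) : ℕ :=
  ((α.take g).map ℓ).sum

@[simp]
theorem offset_zero (ℓ : X → ℕ) (α : List X) : offset ℓ α 0 = 0 := rfl

theorem varAt_succ (α : List X) (g : ℕ) : varAt α (g + 1) = α[g]? := by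
  simp [varAt]

theorem offset_succ {ℓ : X → ℕ} {α : List X} {g : ℕ} {x : X} (h : varAt α (g + 1) = some x) :
    offset ℓ α (g + 1) = offset ℓ α g + ℓ x := by
  rw [varAt_succ] at h
  simp [offset, List.take_add_one, h]

theorem offset_mono (ℓ : X → ℕ) (α : List X) : Monotone (offset ℓ α) := by
  refine monotone_nat_of_le_succ fun g => ?_
  cases h : varAt α (g + 1) with
  | some x => rw [offset_succ h]; omega
  | none =>
    rw [varAt_succ] at h
    simp [offset, List.take_add_one, h]

theorem offset_le_offset_length (ℓ : X → ℕ) (α : List X) (g : ℕ) :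
    offset ℓ α g ≤ offset ℓ α α.length := by
  rcases le_total g α.length with h | h
  · exact offset_mono ℓ α h
  · simp [offset, List.take_of_length_le h]

/-- The factors of `w` at the two positions of a pair agree and lie within `w`, and the right one
is a suffix if it is the last one. -/
def FactorsMatch (w : List S) (ℓ : X → ℕ) (α : List X) (p : ℕ × ℕ) : Prop :=
  offset ℓ α p.2 ≤ w.length ∧ (p.2 = α.length → offset ℓ α p.2 = w.length) ∧
  ∀ x, varAt α p.2 = some x → ∀ s < ℓ x,
    w[offset ℓ α (p.1 - 1) + s]? = w[offset ℓ α (p.2 - 1) + s]?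

/-- `Legal α g₁ g₂ I m`: from behind the first `g₁` and `g₂` factors the heads can perform the
sequence `I` of actions without overtaking each other, and `m` is the sequence of the pairs of
positions that are matched. -/
inductive Legal (α : List X) : ℕ → ℕ → List (X × Act) → List (ℕ × ℕ) → Prop
  | nil (g₁ g₂ : ℕ) : Legal α g₁ g₂ [] []
  | leftForth {g₁ g₂ : ℕ} {x : X} {I : List (X × Act)} {m : List (ℕ × ℕ)} :
      varAt α (g₁ + 1) = some x → g₁ + 1 ≤ g₂ → Legal α (g₁ + 1) g₂ I m →
      Legal α g₁ g₂ ((x, .loop .forth .stay .any) :: I) m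
  | leftBack {g₁ g₂ : ℕ} {x : X} {I : List (X × Act)} {m : List (ℕ × ℕ)} :
      varAt α (g₁ + 1) = some x → g₁ + 1 ≤ g₂ → Legal α g₁ g₂ I m →
      Legal α (g₁ + 1) g₂ ((x, .loop .back .stay .any) :: I) m
  | rightForth {g₁ g₂ : ℕ} {x : X} {I : List (X × Act)} {m : List (ℕ × ℕ)} :
      varAt α (g₂ + 1) = some x → g₁ ≤ g₂ → Legal α g₁ (g₂ + 1) I m →
      Legal α g₁ g₂ ((x, .loop .stay .forth .letter) :: I) m
  | rightBack {g₁ g₂ : ℕ} {x : X} {I : List (X × Act)} {m : List (ℕ × ℕ)} :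
      varAt α (g₂ + 1) = some x → g₁ ≤ g₂ → Legal α g₁ g₂ I m →
      Legal α g₁ (g₂ + 1) ((x, .loop .stay .back .any) :: I) m
  | matchPair {g₁ g₂ : ℕ} {x : X} {I : List (X × Act)} {m : List (ℕ × ℕ)} :
      varAt α (g₁ + 1) = some x → varAt α (g₂ + 1) = some x → g₁ ≤ g₂ →
      Legal α (g₁ + 1) (g₂ + 1) I m →
      Legal α g₁ g₂ ((x, .loop .forth .forth .same) ::
        (x, .test (if g₂ + 1 = α.length then .atEnd else .any)) :: I) ((g₁ + 1, g₂ + 1) :: m)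

/-- If the right head moves forward over letters only, it does not leave the input. -/
theorem add_le_length_of_guard {w : List S} {r₁ : HeadInstr} {g : Guard} (hr : r₁ ≠ .back)
    (hg : ∀ a : TapeSymbol S, ¬ g.Holds a .rightEnd) {a b N : ℕ} (hab : a ≤ b)
    (hb : b ≤ w.length)
    (h : ∀ s < N, g.Holds (tapeAt w ((moveHeads w.length r₁ .forth)^[s] (a + 1, b + 1)).1)
        (tapeAt w ((moveHeads w.length r₁ .forth)^[s] (a + 1, b + 1)).2)) :
    b + N ≤ w.length := by
  by_contra hlt
  -- In this round the right head would scan the right endmarker, which the guard rejects.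
  have h' := h (w.length - b) (by omega)
  rw [moveHeads_iterate w.length r₁ .forth (w.length - b)
    (a' := a + 1 + (w.length - b) * r₁.val.toNat) (b' := w.length + 1)] at h'
  · rw [tapeAt_length_succ] at h'
    exact hg _ h'
  all_goals cases r₁ <;> simp [HeadInstr.val] at hr ⊢ <;> omega

/-! ### Crossing one factor -/

section Offsets

variable {w : List S} {ℓ : X → ℕ} {α : List X} {g₁ g₂ : ℕ} {x : X}

theorem iterate_leftForth (hx : varAt α (g₁ + 1) = some x) (hg : g₁ + 1 ≤ g₂)
    (hw : offset ℓ α g₂ ≤ w.length) :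
    (moveHeads w.length .forth .stay)^[ℓ x] (offset ℓ α g₁ + 1, offset ℓ α g₂ + 1) =
      (offset ℓ α (g₁ + 1) + 1, offset ℓ α g₂ + 1) := by
  have h₁ := offset_succ (ℓ := ℓ) hx
  have h₂ := offset_mono ℓ α hg
  apply moveHeads_iterate <;> (try simp only [HeadInstr.val]) <;> omega

theorem iterate_leftBack (hx : varAt α (g₁ + 1) = some x) (hg : g₁ + 1 ≤ g₂)
    (hw : offset ℓ α g₂ ≤ w.length) :
    (moveHeads w.length .back .stay)^[ℓ x] (offset ℓ α (g₁ + 1) + 1, offset ℓ α g₂ + 1) =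
      (offset ℓ α g₁ + 1, offset ℓ α g₂ + 1) := by
  have h₁ := offset_succ (ℓ := ℓ) hx
  have h₂ := offset_mono ℓ α hg
  apply moveHeads_iterate <;> (try simp only [HeadInstr.val]) <;> omega

theorem iterate_rightForth (hx : varAt α (g₂ + 1) = some x) (hg : g₁ ≤ g₂)
    (hw : offset ℓ α (g₂ + 1) ≤ w.length) :
    (moveHeads w.length .stay .forth)^[ℓ x] (offset ℓ α g₁ + 1, offset ℓ α g₂ + 1) =
      (offset ℓ α g₁ + 1, offset ℓ α (g₂ + 1) + 1) := by
  have h₁ := offset_succ (ℓ := ℓ) hx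
  have h₂ := offset_mono ℓ α hg
  apply moveHeads_iterate <;> (try simp only [HeadInstr.val]) <;> omega

theorem iterate_rightBack (hx : varAt α (g₂ + 1) = some x) (hg : g₁ ≤ g₂)
    (hw : offset ℓ α (g₂ + 1) ≤ w.length) :
    (moveHeads w.length .stay .back)^[ℓ x] (offset ℓ α g₁ + 1, offset ℓ α (g₂ + 1) + 1) =
      (offset ℓ α g₁ + 1, offset ℓ α g₂ + 1) := by
  have h₁ := offset_succ (ℓ := ℓ) hx
  have h₂ := offset_mono ℓ α hg
  apply moveHeads_iterate <;> (try simp only [HeadInstr.val]) <;> omega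

theorem iterate_both (hg : g₁ ≤ g₂) {s : ℕ} (hw : offset ℓ α g₂ + s ≤ w.length) :
    (moveHeads w.length .forth .forth)^[s] (offset ℓ α g₁ + 1, offset ℓ α g₂ + 1) =
      (offset ℓ α g₁ + s + 1, offset ℓ α g₂ + s + 1) := by
  have h₂ := offset_mono ℓ α hg
  apply moveHeads_iterate <;> (try simp only [HeadInstr.val]) <;> omega

theorem iterate_match (hx : varAt α (g₁ + 1) = some x) (hx' : varAt α (g₂ + 1) = some x)
    (hg : g₁ ≤ g₂) (hw : offset ℓ α (g₂ + 1) ≤ w.length) :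
    (moveHeads w.length .forth .forth)^[ℓ x] (offset ℓ α g₁ + 1, offset ℓ α g₂ + 1) =
      (offset ℓ α (g₁ + 1) + 1, offset ℓ α (g₂ + 1) + 1) := by
  rw [offset_succ hx'] at hw
  rw [iterate_both hg hw, offset_succ hx, offset_succ hx']

end Offsets

theorem Guard.same_tapeAt_iff {w : List S} {i j : ℕ} (hij : i ≤ j) (hj : j < w.length) :
    Guard.Holds .same (tapeAt w (i + 1)) (tapeAt w (j + 1)) ↔ w[i]? = w[j]? := by
  have hi : i < w.length := by omega
  rw [tapeAt_succ_of_lt hi, tapeAt_succ_of_lt hj, List.getElem?_eq_getElem hi,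
    List.getElem?_eq_getElem hj]
  simp only [Guard.Holds, TapeSymbol.letter.injEq, Option.some.injEq]
  exact ⟨fun ⟨s, h₁, h₂⟩ => h₁.trans h₂.symm, fun h => ⟨_, h, rfl⟩⟩

/-- If the actions of a legal sequence can be performed, all the pairs of factors match. -/
theorem Legal.factorsMatch {α : List X} {g₁ g₂ : ℕ} {I : List (X × Act)} {m : List (ℕ × ℕ)}
    (hL : Legal α g₁ g₂ I m) {w : List S} {ℓ : X → ℕ} (hw : offset ℓ α g₂ ≤ w.length)
    (hI : Runs w ℓ I (offset ℓ α g₁ + 1, offset ℓ α g₂ + 1)) :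
    ∀ p ∈ m, FactorsMatch w ℓ α p := by
  induction hL with
  | nil => simp
  | leftForth hx hg _ ih =>
    have hI := hI.2
    rw [iterate_leftForth hx hg hw] at hI
    exact ih hw hI
  | leftBack hx hg _ ih =>
    have hI := hI.2
    rw [iterate_leftBack hx hg hw] at hI
    exact ih hw hI
  | rightForth hx hg _ ih =>
    -- The guard `letter` prevents a guessed length from reaching beyond the input, so the bound on
    -- the right offset persists.
    have hw' := add_le_length_of_guard (by simp) (by simp [Guard.Holds]) (offset_mono ℓ α hg) hw
      hI.1
    rw [← offset_succ hx] at hw'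
    have hI := hI.2
    rw [iterate_rightForth hx hg hw'] at hI
    exact ih hw' hI
  | rightBack hx hg _ ih =>
    have hI := hI.2
    rw [iterate_rightBack hx hg hw] at hI
    exact ih ((offset_mono ℓ α (Nat.le_succ _)).trans hw) hI
  | @matchPair g₁ g₂ x I m hx hx' hg _ ih =>
    obtain ⟨h₁, h₂, h₃⟩ := hI
    have hw' := add_le_length_of_guard (by simp) (by simp [Guard.Holds]) (offset_mono ℓ α hg) hw h₁
    have hw'' := hw'
    rw [← offset_succ hx'] at hw''
    rw [iterate_match hx hx' hg hw''] at h₂ h₃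
    have h₄ := offset_mono ℓ α hg
    refine List.forall_mem_cons.2 ⟨⟨hw'', fun hn => ?_, fun y hy s hs => ?_⟩, ih hw'' h₃⟩
    · rw [if_pos hn] at h₂
      exact (tapeAt_eq_rightEnd_iff hw'').1 h₂
    · obtain rfl : x = y := Option.some.inj (hx'.symm.trans hy)
      have := h₁ s hs
      rw [iterate_both hg (by omega)] at this
      simp only [Nat.add_sub_cancel]
      exact (Guard.same_tapeAt_iff (by omega) (by omega)).1 this

/-- If the variables are given the lengths of their images, the actions of a legal sequence can be
performed. -/
theorem Legal.runs {α : List X} {g₁ g₂ : ℕ} {I : List (X × Act)} {m : List (ℕ × ℕ)}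
    (hL : Legal α g₁ g₂ I m) {w : List S} {ℓ : X → ℕ} (hw : offset ℓ α α.length = w.length)
    (hm : ∀ p ∈ m, FactorsMatch w ℓ α p) :
    Runs w ℓ I (offset ℓ α g₁ + 1, offset ℓ α g₂ + 1) := by
  have hle : ∀ g, offset ℓ α g ≤ w.length := fun g => hw ▸ offset_le_offset_length ℓ α g
  induction hL with
  | nil => trivial
  | leftForth hx hg _ ih =>
    refine ⟨fun _ _ => trivial, ?_⟩
    rw [iterate_leftForth hx hg (hle _)]
    exact ih hm
  | leftBack hx hg _ ih =>
    refine ⟨fun _ _ => trivial, ?_⟩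
    rw [iterate_leftBack hx hg (hle _)]
    exact ih hm
  | @rightForth g₁ g₂ x I m hx hg _ ih =>
    have h₁ := offset_succ (ℓ := ℓ) hx
    have h₂ := hle (g₂ + 1)
    have h₃ := offset_mono ℓ α hg
    refine ⟨fun s hs => ?_, ?_⟩
    · rw [moveHeads_iterate w.length .stay .forth s (a' := offset ℓ α g₁ + 1)
        (b' := offset ℓ α g₂ + s + 1)]
      · exact ⟨_, tapeAt_succ_of_lt (by omega)⟩
      all_goals (try simp only [HeadInstr.val])
      all_goals omega
    · rw [iterate_rightForth hx hg h₂]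
      exact ih hm
  | rightBack hx hg _ ih =>
    refine ⟨fun _ _ => trivial, ?_⟩
    rw [iterate_rightBack hx hg (hle _)]
    exact ih hm
  | @matchPair g₁ g₂ x I m hx hx' hg _ ih =>
    have hw'' := hle (g₂ + 1)
    have h₁ := offset_succ (ℓ := ℓ) hx'
    have h₄ := offset_mono ℓ α hg
    obtain ⟨⟨-, h₂, h₃⟩, hm⟩ := List.forall_mem_cons.1 hm
    refine ⟨fun s hs => ?_, ?_⟩
    · rw [iterate_both hg (by omega)]
      exact (Guard.same_tapeAt_iff (by omega) (by omega)).2 (h₃ x hx' s hs)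
    · rw [iterate_match hx hx' hg hw'']
      refine ⟨?_, ih hm⟩
      split_ifs with hn
      · exact (tapeAt_eq_rightEnd_iff hw'').2 (h₂ hn)
      · trivial

/-! ### Legal sequences of actions from operating modes -/

@[simp]
theorem headTrack_nil (μ : Head) : headTrack μ [] = [] := rfl

@[simp]
theorem headTrack_left_cons_left (d : ℕ) (D : List (ℕ × Head)) :
    headTrack .left ((d, .left) :: D) = d :: headTrack .left D := by simp [headTrack]

@[simp]
theorem headTrack_right_cons_right (d : ℕ) (D : List (ℕ × Head)) :
    headTrack .right ((d, .right) :: D) = d :: headTrack .right D := by simp [headTrack]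

@[simp]
theorem headTrack_left_cons_right (d : ℕ) (D : List (ℕ × Head)) :
    headTrack .left ((d, .right) :: D) = headTrack .left D := by simp [headTrack]

@[simp]
theorem headTrack_right_cons_left (d : ℕ) (D : List (ℕ × Head)) :
    headTrack .right ((d, .left) :: D) = headTrack .right D := by simp [headTrack]

/-- In the sequence `D` of head movements the current left element never exceeds the current right
element, if `a` and `b` are the elements that were current before. -/
def NoOvertaking (a b : Option ℕ) (D : List (ℕ × Head)) : Prop :=
  ∀ j < D.length,
    ∀ d ∈ (headTrack .left (D.take (j + 1))).getLast?.or (a.or (headTrack .left D).head?),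
    ∀ e ∈ (headTrack .right (D.take (j + 1))).getLast?.or (b.or (headTrack .right D).head?), d ≤ e

/-- Once the first entry `d` is removed, it takes over the role of the previously current element.
-/
theorem some_getD_or {A : Type*} (o : Option A) (d : A) (p q : Option A) :
    (some (o.getD d)).or p = o.or ((some d).or q) := by
  cases o <;> rfl

theorem NoOvertaking.cons_left {a b : Option ℕ} {d : ℕ} {D : List (ℕ × Head)}
    (h : NoOvertaking a b ((d, .left) :: D)) :
    (∀ e ∈ b.or (headTrack .right D).head?, d ≤ e) ∧ NoOvertaking (some d) b D := by
  constructor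
  · simpa using h 0 (by simp) d
  · intro j hj
    have := h (j + 1) (by simpa using hj)
    simp only [List.take_succ_cons, headTrack_left_cons_left, headTrack_right_cons_left,
      List.getLast?_cons] at this
    rwa [some_getD_or _ _ _ (headTrack .left D).head?] at this

theorem NoOvertaking.cons_right {a b : Option ℕ} {d : ℕ} {D : List (ℕ × Head)}
    (h : NoOvertaking a b ((d, .right) :: D)) :
    (∀ e ∈ a.or (headTrack .left D).head?, e ≤ d) ∧ NoOvertaking a (some d) D := by
  constructor
  · simpa using h 0 (by simp)
  · intro j hj
    have := h (j + 1) (by simpa using hj)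
    simp only [List.take_succ_cons, headTrack_left_cons_right, headTrack_right_cons_right,
      List.getLast?_cons] at this
    rwa [some_getD_or _ _ _ (headTrack .right D).head?] at this

/-- The factors crossed on the way from behind the first `g` factors forward to behind the first
`t` factors. -/
def forthPath (g t : ℕ) : List ℕ := List.range' (g + 1) (t - g)

/-- The factors crossed on the way from behind the first `g` factors back to behind the first
`t` factors. -/
def backPath (g t : ℕ) : List ℕ := (List.range' (t + 1) (g - t)).reverse

theorem nil_eq_forthPath {g t : ℕ} (h : [] = forthPath g t) (hg : g ≤ t) : g = t := by
  have := congrArg List.length h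
  simp [forthPath] at this
  omega

theorem nil_eq_backPath {g t : ℕ} (h : [] = backPath g t) (hg : t ≤ g) : g = t := by
  have := congrArg List.length h
  simp [backPath] at this
  omega

theorem forthPath_of_lt {g t : ℕ} (h : g < t) : forthPath g t = (g + 1) :: forthPath (g + 1) t := by
  obtain ⟨k, rfl⟩ := Nat.exists_eq_add_of_lt h
  simp [forthPath, show g + k + 1 - g = k + 1 by omega, List.range'_succ]

theorem backPath_of_le {g t : ℕ} (h : t ≤ g) : backPath (g + 1) t = (g + 1) :: backPath g t := by
  obtain ⟨k, rfl⟩ := Nat.exists_eq_add_of_le h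
  simp [backPath, show t + k + 1 - t = k + 1 by omega, List.range'_1_concat]
  omega

theorem cons_eq_forthPath {g t d : ℕ} {T : List ℕ} (h : d :: T = forthPath g t) :
    g < t ∧ d = g + 1 ∧ T = forthPath (g + 1) t := by
  have hlt : g < t := by
    by_contra hlt
    simp [forthPath, Nat.sub_eq_zero_of_le (not_lt.1 hlt)] at h
  rw [forthPath_of_lt hlt] at h
  exact ⟨hlt, List.cons.inj h⟩

theorem cons_eq_backPath {g t d : ℕ} {T : List ℕ} (h : d :: T = backPath g t) :
    ∃ g', g = g' + 1 ∧ t ≤ g' ∧ d = g' + 1 ∧ T = backPath g' t := by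
  have hlt : t < g := by
    by_contra hlt
    simp [backPath, Nat.sub_eq_zero_of_le (not_lt.1 hlt)] at h
  obtain ⟨g', rfl⟩ := Nat.exists_eq_add_one_of_ne_zero (Nat.ne_zero_of_lt hlt)
  rw [backPath_of_le (by omega)] at h
  exact ⟨g', rfl, by omega, List.cons.inj h⟩

/-- After matching at `j` a head is behind `j` factors; before matching at `j'` it must be behind
`j' - 1` factors. -/
theorem headPath_of_lt {j j' : ℕ} (h : j < j') : headPath j j' = forthPath j (j' - 1) := by
  simp [headPath, forthPath, h]

theorem headPath_of_le {j j' : ℕ} (h : j' ≤ j) (h' : 0 < j') :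
    headPath j j' = backPath j (j' - 1) := by
  simp [headPath, backPath, not_lt.2 h, Nat.sub_add_cancel h',
    show j - (j' - 1) = j + 1 - j' by omega]

theorem exists_varAt (α : List X) {g : ℕ} (h : g < α.length) : ∃ x, varAt α (g + 1) = some x :=
  ⟨α[g], by rw [varAt_succ, List.getElem?_eq_getElem h]⟩

/-! ### Repairing shuffles so that the heads never cross -/

section Shuffles

variable {α : List X} {I' : List (X × Act)} {m : List (ℕ × ℕ)} {t₁ t₂ : ℕ}

/-- From behind the first `g₁` and `g₂` factors, a legal sequence of actions crosses the factors
in `D` and continues with `I'`. -/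
def Realizable (α : List X) (I' : List (X × Act)) (m : List (ℕ × ℕ)) (D : List (ℕ × Head))
    (g₁ g₂ : ℕ) : Prop :=
  ∃ I, I.map (fun e => some e.1) =
      D.map (fun e => varAt α e.1) ++ I'.map (fun e => some e.1) ∧ Legal α g₁ g₂ I m

theorem Realizable.leftForth {D : List (ℕ × Head)} {g₁ g₂ : ℕ}
    (h : Realizable α I' m D (g₁ + 1) g₂) (hn : g₁ < α.length) (hg : g₁ + 1 ≤ g₂) :
    Realizable α I' m ((g₁ + 1, .left) :: D) g₁ g₂ := by
  obtain ⟨x, hx⟩ := exists_varAt α hn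
  obtain ⟨I, h₁, h₂⟩ := h
  exact ⟨_, by simp [h₁, hx], .leftForth hx hg h₂⟩

theorem Realizable.leftBack {D : List (ℕ × Head)} {g₁ g₂ : ℕ}
    (h : Realizable α I' m D g₁ g₂) (hn : g₁ < α.length) (hg : g₁ + 1 ≤ g₂) :
    Realizable α I' m ((g₁ + 1, .left) :: D) (g₁ + 1) g₂ := by
  obtain ⟨x, hx⟩ := exists_varAt α hn
  obtain ⟨I, h₁, h₂⟩ := h
  exact ⟨_, by simp [h₁, hx], .leftBack hx hg h₂⟩

theorem Realizable.rightForth {D : List (ℕ × Head)} {g₁ g₂ : ℕ}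
    (h : Realizable α I' m D g₁ (g₂ + 1)) (hn : g₂ < α.length) (hg : g₁ ≤ g₂) :
    Realizable α I' m ((g₂ + 1, .right) :: D) g₁ g₂ := by
  obtain ⟨x, hx⟩ := exists_varAt α hn
  obtain ⟨I, h₁, h₂⟩ := h
  exact ⟨_, by simp [h₁, hx], .rightForth hx hg h₂⟩

theorem Realizable.rightBack {D : List (ℕ × Head)} {g₁ g₂ : ℕ}
    (h : Realizable α I' m D g₁ g₂) (hn : g₂ < α.length) (hg : g₁ ≤ g₂) :
    Realizable α I' m ((g₂ + 1, .right) :: D) g₁ (g₂ + 1) := by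
  obtain ⟨x, hx⟩ := exists_varAt α hn
  obtain ⟨I, h₁, h₂⟩ := h
  exact ⟨_, by simp [h₁, hx], .rightBack hx hg h₂⟩

/-- `Realizable` sees only the variables of the entries, not their markers. -/
theorem Realizable.swap {D : List (ℕ × Head)} {g₁ g₂ d : ℕ} {μ μ' : Head}
    (h : Realizable α I' m ((d, μ) :: (d, μ') :: D) g₁ g₂) :
    Realizable α I' m ((d, μ') :: (d, μ) :: D) g₁ g₂ := h

/-- Every shuffle works: the left head stays at or before `t₁` and the right head at or behind `t₂`.
-/
theorem realizable_forth_back (ht : t₁ < t₂) (hL : Legal α t₁ t₂ I' m) (D : List (ℕ × Head)) :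
    ∀ {g₁ g₂ : ℕ}, g₂ ≤ α.length → g₁ ≤ t₁ → t₂ ≤ g₂ → headTrack .left D = forthPath g₁ t₁ →
      headTrack .right D = backPath g₂ t₂ → Realizable α I' m D g₁ g₂ := by
  induction D with
  | nil =>
    intro g₁ g₂ _ h₁ h₂ hl hr
    obtain rfl := nil_eq_forthPath hl h₁
    obtain rfl := nil_eq_backPath hr h₂
    exact ⟨I', rfl, hL⟩
  | cons e D ih =>
    obtain ⟨d, _ | _⟩ := e <;> intro g₁ g₂ hn h₁ h₂ hl hr <;>
      simp only [headTrack_left_cons_left, headTrack_left_cons_right,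
        headTrack_right_cons_left, headTrack_right_cons_right] at hl hr
    · obtain ⟨hlt, rfl, hl'⟩ := cons_eq_forthPath hl
      exact (ih hn hlt h₂ hl' hr).leftForth (by omega) (by omega)
    · obtain ⟨g, rfl, hlt, rfl, hr'⟩ := cons_eq_backPath hr
      exact (ih (by omega) h₁ hlt hl hr').rightBack (by omega) (by omega)

/-- Every shuffle works, as the heads only move apart. -/
theorem realizable_back_forth (hn : t₂ ≤ α.length) (hL : Legal α t₁ t₂ I' m)
    (D : List (ℕ × Head)) :
    ∀ {g₁ g₂ : ℕ}, g₁ ≤ g₂ → t₁ ≤ g₁ → g₂ ≤ t₂ → headTrack .left D = backPath g₁ t₁ →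
      headTrack .right D = forthPath g₂ t₂ → Realizable α I' m D g₁ g₂ := by
  induction D with
  | nil =>
    intro g₁ g₂ _ h₁ h₂ hl hr
    obtain rfl := nil_eq_backPath hl h₁
    obtain rfl := nil_eq_forthPath hr h₂
    exact ⟨I', rfl, hL⟩
  | cons e D ih =>
    obtain ⟨d, _ | _⟩ := e <;> intro g₁ g₂ hg h₁ h₂ hl hr <;>
      simp only [headTrack_left_cons_left, headTrack_left_cons_right,
        headTrack_right_cons_left, headTrack_right_cons_right] at hl hr
    · obtain ⟨g, rfl, hlt, rfl, hl'⟩ := cons_eq_backPath hl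
      exact (ih (by omega) hlt h₂ hl' hr).leftBack (by omega) (by omega)
    · obtain ⟨hlt, rfl, hr'⟩ := cons_eq_forthPath hr
      exact (ih (by omega) h₁ hlt hl hr').rightForth (by omega) (by omega)

/-- Here `b` is the factor the right head crossed last, if any. The induction is on a length bound,
since a swap consumes two entries at once. -/
theorem realizable_forth_forth (ht : t₁ < t₂) (hn : t₂ ≤ α.length) (hL : Legal α t₁ t₂ I' m)
    (N : ℕ) : ∀ (D : List (ℕ × Head)), D.length ≤ N → ∀ {g₁ g₂ : ℕ} {a b : Option ℕ},
      g₁ ≤ g₂ → g₁ ≤ t₁ → g₂ ≤ t₂ → headTrack .left D = forthPath g₁ t₁ →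
      headTrack .right D = forthPath g₂ t₂ → (b = none ∨ b = some g₂) → NoOvertaking a b D →
      Realizable α I' m D g₁ g₂ := by
  induction N with
  | zero =>
    intro D hD g₁ g₂ a b _ h₁ h₂ hl hr _ _
    obtain rfl := List.length_eq_zero_iff.1 (Nat.le_zero.1 hD)
    obtain rfl := nil_eq_forthPath hl h₁
    obtain rfl := nil_eq_forthPath hr h₂
    exact ⟨I', rfl, hL⟩
  | succ N ih =>
    rintro (_ | ⟨⟨d, _ | _⟩, D⟩) hD g₁ g₂ a b hg h₁ h₂ hl hr hb hno <;>
      simp only [headTrack_nil, headTrack_left_cons_left, headTrack_left_cons_right,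
        headTrack_right_cons_left, headTrack_right_cons_right] at hl hr
    · obtain rfl := nil_eq_forthPath hl h₁
      obtain rfl := nil_eq_forthPath hr h₂
      exact ⟨I', rfl, hL⟩
    · simp only [List.length_cons, Nat.add_le_add_iff_right] at hD
      obtain ⟨hlt, rfl, hl'⟩ := cons_eq_forthPath hl
      obtain ⟨hno₀, hno⟩ := hno.cons_left
      rcases hg.lt_or_eq with hg | rfl
      · exact (ih D hD hg hlt h₂ hl' hr hb hno).leftForth (by omega) (by omega)
      -- Both heads are at the same boundary and the left one is listed first. The right head still
      -- has to move since `t₁ < t₂`. The condition on current elements forces that it has not moved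
      -- yet and that the next entry is its crossing of the same factor; these two entries are
      -- swapped.
      · have hr₀ := hr
        rw [forthPath_of_lt (by omega)] at hr₀
        obtain rfl : b = none := by
          rcases hb with hb | rfl
          · exact hb
          · have := hno₀ _ rfl
            omega
        rcases D with _ | ⟨⟨d, _ | _⟩, D⟩
        · simp at hr₀
        · rw [headTrack_left_cons_left] at hl'
          rw [headTrack_right_cons_left] at hr₀
          obtain ⟨_, rfl, _⟩ := cons_eq_forthPath hl'
          have := hno.cons_left.1 (g₁ + 1) (by simp [hr₀])
          omega
        · rw [headTrack_left_cons_right] at hl'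
          rw [headTrack_right_cons_right] at hr
          obtain ⟨hlt', rfl, hr'⟩ := cons_eq_forthPath hr
          simp only [List.length_cons] at hD
          exact Realizable.swap <| Realizable.rightForth ((ih D (by omega) le_rfl hlt hlt' hl' hr'
            (.inr rfl) hno.cons_right.2).leftForth (by omega) le_rfl) (by omega) le_rfl
    · simp only [List.length_cons, Nat.add_le_add_iff_right] at hD
      obtain ⟨hlt, rfl, hr'⟩ := cons_eq_forthPath hr
      exact (ih D hD (by omega) h₁ hlt hl hr' (.inr rfl) hno.cons_right.2).rightForth
        (by omega) hg

/-- The mirror image: the right head may be listed first at a common boundary. Going back, the left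
head crossed factor `g₁ + 1` last. -/
theorem realizable_back_back (ht : t₁ < t₂) (hL : Legal α t₁ t₂ I' m)
    (N : ℕ) : ∀ (D : List (ℕ × Head)), D.length ≤ N → ∀ {g₁ g₂ : ℕ} {a b : Option ℕ},
      g₂ ≤ α.length → g₁ ≤ g₂ → t₁ ≤ g₁ → t₂ ≤ g₂ → headTrack .left D = backPath g₁ t₁ →
      headTrack .right D = backPath g₂ t₂ → (a = none ∨ a = some (g₁ + 1)) → NoOvertaking a b D →
      Realizable α I' m D g₁ g₂ := by
  induction N with
  | zero =>
    intro D hD g₁ g₂ a b _ _ h₁ h₂ hl hr _ _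
    obtain rfl := List.length_eq_zero_iff.1 (Nat.le_zero.1 hD)
    obtain rfl := nil_eq_backPath hl h₁
    obtain rfl := nil_eq_backPath hr h₂
    exact ⟨I', rfl, hL⟩
  | succ N ih =>
    rintro (_ | ⟨⟨d, _ | _⟩, D⟩) hD g₁ g₂ a b hn hg h₁ h₂ hl hr ha hno <;>
      simp only [headTrack_nil, headTrack_left_cons_left, headTrack_left_cons_right,
        headTrack_right_cons_left, headTrack_right_cons_right] at hl hr
    · obtain rfl := nil_eq_backPath hl h₁
      obtain rfl := nil_eq_backPath hr h₂
      exact ⟨I', rfl, hL⟩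
    · simp only [List.length_cons, Nat.add_le_add_iff_right] at hD
      obtain ⟨g, rfl, hlt, rfl, hl'⟩ := cons_eq_backPath hl
      exact (ih D hD hn (by omega) hlt h₂ hl' hr (.inr rfl) hno.cons_left.2).leftBack
        (by omega) hg
    · simp only [List.length_cons, Nat.add_le_add_iff_right] at hD
      obtain ⟨g, rfl, hlt, rfl, hr'⟩ := cons_eq_backPath hr
      obtain ⟨hno₀, hno⟩ := hno.cons_right
      rcases hg.lt_or_eq with hg | rfl
      · exact (ih D hD (by omega) (by omega) h₁ hlt hl hr' ha hno).rightBack (by omega) (by omega)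
      · have hl₀ := hl
        rw [backPath_of_le (by omega)] at hl₀
        obtain rfl : a = none := by
          rcases ha with ha | rfl
          · exact ha
          · have := hno₀ _ rfl
            omega
        rcases D with _ | ⟨⟨d, _ | _⟩, D⟩
        · simp at hl₀
        · rw [headTrack_left_cons_left] at hl
          rw [headTrack_right_cons_left] at hr'
          obtain ⟨g', hg', hlt', rfl, hl'⟩ := cons_eq_backPath hl
          obtain rfl : g = g' := by omega
          simp only [List.length_cons] at hD
          exact Realizable.swap <| Realizable.leftBack ((ih D (by omega) (by omega) le_rfl hlt' hlt
            hl' hr' (.inr rfl) hno.cons_left.2).rightBack (by omega) le_rfl) (by omega) le_rfl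
        · rw [headTrack_left_cons_right] at hl₀
          rw [headTrack_right_cons_right] at hr'
          obtain ⟨g', rfl, _, rfl, _⟩ := cons_eq_backPath hr'
          have := hno.cons_right.1 (g' + 1 + 1) (by simp [hl₀])
          omega

theorem IsHeadMovement.realizable {p p' : ℕ × ℕ} {D : List (ℕ × Head)}
    (hD : IsHeadMovement p p' D) (hp : p.1 ≤ p.2) (hpn : p.2 ≤ α.length) (h₀ : 0 < p'.1)
    (hp' : p'.1 < p'.2) (hpn' : p'.2 ≤ α.length)
    (hL : Legal α (p'.1 - 1) (p'.2 - 1) I' m) : Realizable α I' m D p.1 p.2 := by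
  obtain ⟨hl, hr, hno⟩ := hD
  -- With nothing current beforehand the two conditions agree by definition.
  have hno : NoOvertaking none none D := hno
  have ht : p'.1 - 1 < p'.2 - 1 := by omega
  rcases lt_or_ge p.1 p'.1 with h₁ | h₁ <;> rcases lt_or_ge p.2 p'.2 with h₂ | h₂
  · rw [headPath_of_lt h₁] at hl
    rw [headPath_of_lt h₂] at hr
    exact realizable_forth_forth ht (by omega) hL _ D le_rfl hp (by omega) (by omega) hl hr
      (.inl rfl) hno
  · rw [headPath_of_lt h₁] at hl
    rw [headPath_of_le h₂ (by omega)] at hr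
    exact realizable_forth_back ht hL D hpn (by omega) (by omega) hl hr
  · rw [headPath_of_le h₁ h₀] at hl
    rw [headPath_of_lt h₂] at hr
    exact realizable_back_forth (by omega) hL D hp (by omega) (by omega) hl hr
  · rw [headPath_of_le h₁ h₀] at hl
    rw [headPath_of_le h₂ (by omega)] at hr
    exact realizable_back_back ht hL _ D le_rfl hpn hp (by omega) (by omega) hl hr
      (.inl rfl) hno

end Shuffles

theorem lt_length_of_varAt {α : List X} {j : ℕ} {x : X} (h : varAt α j = some x) :
    0 < j ∧ j ≤ α.length := by
  rcases j with _ | j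
  · simp [varAt] at h
  · rw [varAt_succ] at h
    exact ⟨j.succ_pos, (List.getElem?_eq_some_iff.1 h).1⟩

/-- The head movements of a mode that is derived from valid matching positions can be performed by
a legal sequence of actions on the same variables. -/
theorem DerivedFrom.exists_legal {α : List X} {p : ℕ × ℕ} {m : List (ℕ × ℕ)}
    {Δ : List (List (ℕ × Head))} (hΔ : DerivedFrom p m Δ) (hp : p.1 ≤ p.2)
    (hpn : p.2 ≤ α.length)
    (hm : ∀ q ∈ m, q.1 < q.2 ∧ ∃ x, varAt α q.1 = some x ∧ varAt α q.2 = some x) :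
    ∃ I : List (X × Act), I.map (fun e => some e.1) = Δ.flatten.map (fun e => varAt α e.1) ∧
      Legal α p.1 p.2 I m := by
  induction hΔ with
  | nil p => exact ⟨[], rfl, .nil _ _⟩
  | cons p p' m D Δ hD _ ih =>
    obtain ⟨⟨hlt, x, hx₁, hx₂⟩, hm⟩ := List.forall_mem_cons.1 hm
    have h₁ := lt_length_of_varAt hx₁
    have h₂ := lt_length_of_varAt hx₂
    obtain ⟨I, hI, hL⟩ := ih hlt.le h₂.2 hm
    obtain ⟨l, r⟩ := p'
    obtain ⟨l, rfl⟩ := Nat.exists_eq_add_one_of_ne_zero h₁.1.ne'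
    obtain ⟨r, rfl⟩ := Nat.exists_eq_add_one_of_ne_zero h₂.1.ne'
    -- Its loop and its test stand for the two closing entries `(r, ρ), (l, λ)`, so actions and
    -- entries correspond one to one.
    have hL' := Legal.matchPair hx₁ hx₂ (by simp at hlt; omega) hL
    obtain ⟨J, hJ, hLJ⟩ := hD.realizable hp hpn h₁.1 hlt h₂.2 hL'
    refine ⟨J, ?_, hLJ⟩
    simp only at hx₁ hx₂
    simp [hJ, hI, hx₁, hx₂]

/-! ### Complete matching orders -/

theorem varPos_disjoint {α : List X} {x y : X} {j : ℕ} (hx : j ∈ varPos α x) (hy : j ∈ varPos α y) :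
    x = y :=
  Option.some.inj ((show varAt α j = some x from hx).symm.trans hy)

theorem mem_of_varAt {α : List X} {j : ℕ} {x : X} (h : varAt α j = some x) : x ∈ α := by
  unfold varAt at h
  split_ifs at h
  exact List.mem_of_getElem? h

section Matching

variable [DecidableEq X]

theorem varPos_eq (α : List X) (x : X) :
    varPos α x = ((α.idxsOf x).toFinset.map (addRightEmbedding 1) : Finset ℕ) := by
  ext j
  rcases j with _ | j
  · simp [varPos, varAt]
  · simp [varPos, varAt_succ, List.getElem?_eq_some_iff]

theorem card_varPos (α : List X) (x : X) : Nat.card (varPos α x) = α.count x := by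
  rw [varPos_eq, Nat.card_coe_set_eq, Set.ncard_coe_finset, Finset.card_map,
    List.toFinset_card_of_nodup List.nodup_idxsOf, List.length_idxsOf]

/-- A connected graph has at least one edge fewer than vertices, and each edge comes from a distinct
pair in `L`. -/
theorem IsMatchingOrder.count_le {α : List X} {x : X} {L : List (ℕ × ℕ)}
    (h : IsMatchingOrder α x L) : α.count x ≤ L.toFinset.card + 1 := by
  obtain ⟨-, hL, hc⟩ := h
  have h₁ := hc.card_vert_le_card_edgeSet_add_one
  rw [card_varPos] at h₁
  let f : L.toFinset → Sym2 (varPos α x) := fun p =>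
    s(⟨p.1.1, (hL p.1 (List.mem_toFinset.1 p.2)).1⟩, ⟨p.1.2, (hL p.1 (List.mem_toFinset.1 p.2)).2.1⟩)
  have hf : (matchingGraph α x L).edgeSet ⊆ Set.range f := by
    intro e
    induction e with
    | _ a b =>
    rw [SimpleGraph.mem_edgeSet, matchingGraph, SimpleGraph.fromRel_adj]
    rintro ⟨-, h | h⟩
    · exact ⟨⟨_, List.mem_toFinset.2 h⟩, rfl⟩
    · exact ⟨⟨_, List.mem_toFinset.2 h⟩, Sym2.eq_swap⟩
  have h₂ := Nat.card_mono (Set.finite_range f) hf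
  have h₃ := Finite.card_range_le f
  rw [Nat.card_eq_fintype_card (α := L.toFinset), Fintype.card_coe] at h₃
  omega

/-- All the pairs in a complete matching order are pairs of positions of the same variable. -/
theorem IsCompleteMatchingOrder.valid {α : List X} {m : List (ℕ × ℕ)}
    (hm : IsCompleteMatchingOrder α m) :
    ∀ q ∈ m, q.1 < q.2 ∧ ∃ x, varAt α q.1 = some x ∧ varAt α q.2 = some x := by
  obtain ⟨μ, hμ, hlen, hsub⟩ := hm
  -- The disjoint matching orders already contain at least `∑ (n_x - 1)` distinct pairs, which is
  -- the length of `m`.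
  have hU : α.toFinset.biUnion (fun x => (μ x).toFinset) = m.toFinset := by
    apply Finset.eq_of_subset_of_card_le
    · intro p
      simp only [Finset.mem_biUnion, List.mem_toFinset]
      rintro ⟨x, hx, hp⟩
      exact hsub x hx p hp
    · rw [Finset.card_biUnion]
      · refine (List.toFinset_card_le m).trans (hlen.trans_le (Finset.sum_le_sum fun x hx => ?_))
        have := (hμ x (List.mem_toFinset.1 hx)).count_le
        omega
      · intro x hx y hy hxy
        rw [Function.onFun, Finset.disjoint_left]
        intro p hpx hpy
        exact hxy (varPos_disjoint
          ((hμ x (List.mem_toFinset.1 hx)).2.1 p (List.mem_toFinset.1 hpx)).1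
          ((hμ y (List.mem_toFinset.1 hy)).2.1 p (List.mem_toFinset.1 hpy)).1)
  intro q hq
  rw [← List.mem_toFinset, ← hU] at hq
  simp only [Finset.mem_biUnion, List.mem_toFinset] at hq
  obtain ⟨x, hx, hq⟩ := hq
  obtain ⟨h₁, h₂, h₃⟩ := (hμ x hx).2.1 q hq
  exact ⟨h₃, x, h₁, h₂⟩

/-- If the two positions of each pair of a complete matching order have the same value, so have all
the positions of a variable. -/
theorem IsCompleteMatchingOrder.eq_of_varAt_eq {A : Type*} {α : List X} {m : List (ℕ × ℕ)}
    (hm : IsCompleteMatchingOrder α m) (F : ℕ → A) (hF : ∀ q ∈ m, F q.1 = F q.2) {x : X} {i j : ℕ}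
    (hi : varAt α i = some x) (hj : varAt α j = some x) : F i = F j := by
  obtain ⟨μ, hμ, -, hsub⟩ := hm
  have hx := mem_of_varAt hi
  obtain ⟨p⟩ := (hμ x hx).2.2.preconnected ⟨i, hi⟩ ⟨j, hj⟩
  have key : ∀ {a b : varPos α x}, (matchingGraph α x (μ x)).Walk a b → F a = F b := by
    intro a b p
    induction p with
    | nil => rfl
    | cons h _ ih =>
      rw [matchingGraph, SimpleGraph.fromRel_adj] at h
      rw [← ih]
      rcases h.2 with h | h
      · exact hF _ (hsub x hx _ h)
      · exact (hF _ (hsub x hx _ h)).symm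
  exact key p

end Matching

/-! ### The allocation of counters -/

/-- Greedy colouring along `v`: at a first occurrence at most `k` variables are live, so one of the
`k + 1` counters is free. -/
theorem exists_isAllocation {k : ℕ} (v : List X)
    (hv : ∀ p x s, v = p ++ x :: s → x ∉ p → {z | z ∈ p ∧ z ∈ s}.ncard ≤ k) :
    ∃ c : X → Fin (k + 1), IsAllocation c v := by
  classical
  suffices h : ∀ t, ∃ c : X → Fin (k + 1), ∀ p x s, v = p ++ x :: s → p.length < t → x ∉ p →
      ∀ z ∈ p, z ∈ s → c z ≠ c x by
    obtain ⟨c, hc⟩ := h v.length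
    exact ⟨c, fun p x s hp => hc p x s hp (by simp [hp])⟩
  intro t
  induction t with
  | zero => exact ⟨fun _ => 0, by simp⟩
  | succ t ih =>
    obtain ⟨c, hc⟩ := ih
    by_cases ht : ∃ p x s, v = p ++ x :: s ∧ p.length = t ∧ x ∉ p
    · obtain ⟨p, x, s, hp, hpt, hx⟩ := ht
      have hfin : {z | z ∈ p ∧ z ∈ s}.Finite := p.finite_toSet.subset fun z hz => hz.1
      obtain ⟨i, hi⟩ : ∃ i, i ∉ c '' {z | z ∈ p ∧ z ∈ s} := by
        by_contra! hall
        have h₁ := Set.ncard_image_le (f := c) hfin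
        rw [Set.eq_univ_of_forall hall, Set.ncard_univ, Nat.card_eq_fintype_card,
          Fintype.card_fin] at h₁
        have := hv p x s hp hx
        omega
      -- As `x` is not in `p`, the change does not affect the conditions at earlier places.
      refine ⟨Function.update c x i, fun p' x' s' hp' ht' hx' z hz hz' => ?_⟩
      rcases Nat.lt_succ_iff_lt_or_eq.1 ht' with hlt | heq
      · have hsub : p' ++ [x'] <+: p := by
          refine List.prefix_of_prefix_length_le (l₃ := v) ⟨s', by simp [hp']⟩ ⟨x :: s, hp.symm⟩ ?_
          simp; omega
        have hzx : z ≠ x := fun h => hx (hsub.subset (by simp [← h, hz]))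
        have hxx : x' ≠ x := fun h => hx (hsub.subset (by simp [← h]))
        rw [Function.update_of_ne hzx, Function.update_of_ne hxx]
        exact hc p' x' s' hp' hlt hx' z hz hz'
      · obtain ⟨rfl, h⟩ := List.append_inj (hp'.symm.trans hp) (heq.trans hpt.symm)
        obtain ⟨rfl, rfl⟩ := List.cons.inj h
        have hzx : z ≠ x' := fun h => hx' (h ▸ hz)
        rw [Function.update_of_ne hzx, Function.update_self]
        exact fun h => hi ⟨z, ⟨hz, hz'⟩, h⟩
    · refine ⟨c, fun p x s hp hpt hx => ?_⟩
      rcases Nat.lt_succ_iff_lt_or_eq.1 hpt with hlt | heq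
      · exact hc p x s hp hlt hx
      · exact absurd ⟨p, x, s, hp, heq, hx⟩ ht

/-- The counter number bounds the number of variables in use when a new variable appears. -/
theorem ncard_le_counterNumber {α : List X} {Δ : List (List (ℕ × Head))} {v : List X}
    (hv : v.map some = Δ.flatten.map fun e => varAt α e.1) (p : List X) (x : X) (s : List X)
    (hp : v = p ++ x :: s) (hx : x ∉ p) :
    {z | z ∈ p ∧ z ∈ s}.ncard ≤ counterNumber α Δ := by
  have hlen : v.length = Δ.flatten.length := by
    have := congrArg List.length hv
    rwa [List.length_map, List.length_map] at this
  have hget : ∀ (i : ℕ) (h : i < Δ.flatten.length), varAt α (Δ.flatten.get ⟨i, h⟩).1 = v[i]? := by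
    intro i h
    have := congrArg (fun l => l[i]?) hv
    simp only [List.getElem?_map, List.getElem?_eq_getElem h,
      List.getElem?_eq_getElem (hlen ▸ h : i < v.length), Option.map_some, Option.some.injEq] at this
    rw [List.getElem?_eq_getElem (hlen ▸ h : i < v.length)]
    exact this.symm
  have hlt : p.length < Δ.flatten.length := by rw [← hlen, hp]; simp
  refine le_trans (Set.ncard_le_ncard ?_ ?_) (Finset.le_sup
    (f := fun i : Fin Δ.flatten.length => (crossingVars α Δ i).ncard)
    (Finset.mem_univ (⟨p.length, hlt⟩ : Fin Δ.flatten.length)))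
  · rintro z ⟨hzp, hzs⟩
    obtain ⟨i, hi, rfl⟩ := List.mem_iff_getElem.1 hzp
    obtain ⟨j, hj, hij⟩ := List.mem_iff_getElem.1 hzs
    have hj' : p.length + 1 + j < Δ.flatten.length := by rw [← hlen, hp]; simp; omega
    refine ⟨⟨⟨i, hi.trans hlt⟩, ⟨p.length + 1 + j, hj'⟩, hi, ?_, ?_, ?_⟩, ?_⟩
    · simp only [Fin.lt_def]; omega
    · rw [hget, hp, List.getElem?_append_left hi, List.getElem?_eq_getElem hi]
    · rw [hget, hp, List.getElem?_append_right (by omega),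
        show p.length + 1 + j - p.length = j + 1 by omega, List.getElem?_cons_succ,
        List.getElem?_eq_getElem hj, hij]
    · rw [hget, hp, List.getElem?_append_right le_rfl, Nat.sub_self]
      simp only [List.getElem?_cons_zero, ne_eq, Option.some.injEq]
      rintro rfl
      exact hx (List.getElem_mem hi)
  · refine α.finite_toSet.subset ?_
    rintro z ⟨⟨_, _, _, _, h, _⟩, _⟩
    exact mem_of_varAt h

/-! ### Factorizations of the input -/

theorem List.take_succ_flatMap_of_varAt {α : List X} {g : ℕ} {x : X}
    (h : varAt α (g + 1) = some x) (σ : X → List S) :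
    (α.take (g + 1)).flatMap σ = (α.take g).flatMap σ ++ σ x := by
  rw [varAt_succ] at h
  simp [List.take_add_one, h]

/-- If the factors at the pairs of a complete matching order match for some lengths of the
variables, the input is in the pattern language. -/
theorem mem_patternLanguage_of_factorsMatch [DecidableEq X] {α : List X} (hα : α ≠ [])
    {m : List (ℕ × ℕ)} (hm : IsCompleteMatchingOrder α m) {w : List S} {ℓ : X → ℕ}
    (hw : ∀ q ∈ m, FactorsMatch w ℓ α q) : w ∈ patternLanguage S α := by
  classical
  -- The corrected factor boundaries: uncompared factors are cut off at the end of `w`, and the last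
  -- factor extends to it.
  let Q : ℕ → ℕ := fun g => if g < α.length then min (offset ℓ α g) w.length else w.length
  have hQ : Monotone Q := by
    intro a b hab
    have := offset_mono ℓ α hab
    simp only [Q]
    split_ifs <;> omega
  -- Up to a compared position nothing is changed; if this is the last position, the end test has
  -- fixed its offset.
  have hQle : ∀ {g j}, g ≤ j → offset ℓ α j ≤ w.length →
      (j = α.length → offset ℓ α j = w.length) → j ≤ α.length → Q g = offset ℓ α g := by
    intro g j hg h₁ h₂ hj
    have := offset_mono ℓ α hg
    simp only [Q]
    split_ifs with h
    · omega
    · obtain rfl : g = j := by omega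
      exact (h₂ (by omega)).symm
  let F : ℕ → List S := fun g => (w.drop (Q (g - 1))).take (Q g - Q (g - 1))
  have hF : ∀ q ∈ m, F q.1 = F q.2 := by
    intro q hq
    obtain ⟨h₁, h₂, h₃⟩ := hw q hq
    obtain ⟨hlt, x, hx₁, hx₂⟩ := hm.valid q hq
    obtain ⟨i, j⟩ := q
    obtain ⟨i, rfl⟩ := Nat.exists_eq_add_one_of_ne_zero (lt_length_of_varAt hx₁).1.ne'
    obtain ⟨j, rfl⟩ := Nat.exists_eq_add_one_of_ne_zero (lt_length_of_varAt hx₂).1.ne'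
    have hjn := (lt_length_of_varAt hx₂).2
    simp only [Nat.add_sub_cancel] at *
    have hQ' : ∀ {g}, g ≤ j + 1 → Q g = offset ℓ α g := fun hg => hQle hg h₁ h₂ hjn
    simp only [F, Nat.add_sub_cancel]
    rw [hQ' (by omega), hQ' (by omega), hQ' (by omega), hQ' (by omega), offset_succ hx₁,
      offset_succ hx₂, Nat.add_sub_cancel_left, Nat.add_sub_cancel_left]
    refine List.ext_getElem? fun s => ?_
    simp only [List.getElem?_take, List.getElem?_drop]
    split_ifs with hs
    · exact h₃ x hx₂ s hs
    · rfl
  -- The chosen position is immaterial by `eq_of_varAt_eq`.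
  let σ : X → List S := fun x => if h : ∃ j, varAt α j = some x then F h.choose else []
  have hσ : ∀ {j x}, varAt α j = some x → σ x = F j := by
    intro j x hj
    have h : ∃ j, varAt α j = some x := ⟨j, hj⟩
    simp only [σ, dif_pos h]
    exact hm.eq_of_varAt_eq F hF h.choose_spec hj
  have key : ∀ g ≤ α.length, (α.take g).flatMap σ = w.take (Q g) := by
    intro g
    induction g with
    | zero =>
      intro _
      -- For the empty pattern `Q 0` would be `w.length`.
      have : Q 0 = 0 := by simp [Q, List.length_pos_iff.2 hα]
      simp [this]
    | succ g ih =>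
      intro hg
      obtain ⟨x, hx⟩ := exists_varAt α hg
      have hle := hQ (Nat.le_succ g)
      rw [List.take_succ_flatMap_of_varAt hx, ih (by omega), hσ hx, ← Nat.add_sub_cancel' hle,
        List.take_add]
      simp [F]
  refine ⟨σ, ?_⟩
  have := key α.length le_rfl
  simpa [Q] using this.symm

/-! ### Factors of a morphic image -/

section Image

variable {α : List X} {σ : X → List S} {ℓ : X → ℕ}

theorem length_flatMap_take (hℓ : ∀ x ∈ α, ℓ x = (σ x).length) (g : ℕ) :
    ((α.take g).flatMap σ).length = offset ℓ α g := by
  rw [List.length_flatMap, offset]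
  congr 1
  exact List.map_congr_left fun x hx => (hℓ x (List.mem_of_mem_take hx)).symm

theorem getElem?_flatMap_offset (hℓ : ∀ x ∈ α, ℓ x = (σ x).length) {g : ℕ} {x : X}
    (hx : varAt α (g + 1) = some x) {s : ℕ} (hs : s < ℓ x) :
    (α.flatMap σ)[offset ℓ α g + s]? = (σ x)[s]? := by
  have h : α.flatMap σ = ((α.take g).flatMap σ ++ σ x) ++ (α.drop (g + 1)).flatMap σ := by
    rw [← List.take_succ_flatMap_of_varAt hx, ← List.flatMap_append, List.take_append_drop]
  have hx' := hℓ x (mem_of_varAt hx)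
  have hl := length_flatMap_take hℓ g
  rw [h, List.getElem?_append_left (by rw [List.length_append]; omega),
    List.getElem?_append_right (by omega), hl, Nat.add_sub_cancel_left]

theorem factorsMatch_flatMap (hℓ : ∀ x ∈ α, ℓ x = (σ x).length) {q : ℕ × ℕ} {x : X}
    (h₁ : varAt α q.1 = some x) (h₂ : varAt α q.2 = some x) :
    FactorsMatch (α.flatMap σ) ℓ α q := by
  have hl : (α.flatMap σ).length = offset ℓ α α.length := by
    rw [← length_flatMap_take hℓ, List.take_length]
  refine ⟨hl ▸ offset_le_offset_length ℓ α _, fun h => by rw [h, hl], fun y hy s hs => ?_⟩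
  obtain rfl : x = y := Option.some.inj (h₂.symm.trans hy)
  obtain ⟨i, j⟩ := q
  obtain ⟨i, rfl⟩ := Nat.exists_eq_add_one_of_ne_zero (lt_length_of_varAt h₁).1.ne'
  obtain ⟨j, rfl⟩ := Nat.exists_eq_add_one_of_ne_zero (lt_length_of_varAt h₂).1.ne'
  simp only [Nat.add_sub_cancel] at *
  rw [getElem?_flatMap_offset hℓ h₁ hs, getElem?_flatMap_offset hℓ h₂ hs]

end Image

end Patterns

/-! ### The main theorem -/

theorem mainTheorem3 {X S : Type*} [DecidableEq X] [Finite S] [Nonempty S]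
    (α : List X) (hα : α ≠ []) (Δ : List (List (ℕ × Head))) (hΔ : IsJanusOperatingMode α Δ) :
    ∃ M : JanusAutomaton (counterNumber α Δ + 1) S, M.language = patternLanguage S α := by
  obtain ⟨m, hm, hD⟩ := hΔ
  obtain ⟨I, hI, hL⟩ := hD.exists_legal le_rfl (Nat.zero_le _) hm.valid
  obtain ⟨c, hc⟩ := exists_isAllocation (I.map Prod.fst)
    (ncard_le_counterNumber (α := α) (Δ := Δ) (by rw [List.map_map]; exact hI))
  refine ⟨ofProgram S (.step .forth .forth .any :: compile c [] I), ?_⟩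
  ext w
  rw [mem_language_compile I hc w]
  constructor
  · rintro ⟨ℓ, -, hr⟩
    exact mem_patternLanguage_of_factorsMatch hα hm
      (hL.factorsMatch (Nat.zero_le _) (by simpa using hr))
  · rintro ⟨σ, rfl⟩
    -- Images of variables outside `α` may be longer than the input, which no counter bound may
    -- exceed.
    let ℓ : X → ℕ := fun x => if x ∈ α then (σ x).length else 0
    have hℓ : ∀ x ∈ α, ℓ x = (σ x).length := fun x hx => if_pos hx
    have hl : offset ℓ α α.length = (α.flatMap σ).length := by
      rw [← length_flatMap_take hℓ, List.take_length]
    refine ⟨ℓ, fun x => ?_, ?_⟩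
    · by_cases hx : x ∈ α
      · obtain ⟨g, hg, rfl⟩ := List.mem_iff_getElem.1 hx
        have h₁ : varAt α (g + 1) = some α[g] := by
          rw [varAt_succ, List.getElem?_eq_getElem hg]
        have h₂ := offset_succ (ℓ := ℓ) h₁
        have h₃ := offset_le_offset_length ℓ α (g + 1)
        omega
      · simp [ℓ, hx]
    · have := hL.runs hl fun q hq => by
        obtain ⟨-, x, h₁, h₂⟩ := hm.valid q hq
        exact factorsMatch_flatMap hℓ h₁ h₂
      simpa using this
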